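/- Let $\xi,\eta\in(0,\pi)$ be such that $\xi/\pi$ and $\eta/\pi$ are irrational, and let $w_k(x)=\sqrt{2/\pi}\,\sin kx$ for $k=1,2,\dots$. For $\alpha\in\mathbb R$ and $\beta\in\{\xi,\eta\}$ let $D^\alpha_\beta$ be the real Hilbert space obtained by completing the linear hull of the functions $w_k$ with respect to the norm $$\Bigl\|\sum a_kw_k\Bigr\|_{D^\alpha_\beta}^2=\sum k^{2\alpha}\sin^2(k\beta)\,|a_k|^2 ,$$ its elements being identified with series $\sum a_kw_k$ of finite norm, on which $\Delta$ acts by $\Delta w_k=-k^2w_k$. Put $$\mathcal H'_{\xi,\eta}=D^0_\xi\times D^0_\eta\times D^{-1}_\xi\times D^{-2}_\eta,\qquad \mathcal G=\mathbb R^2,$$ $$D(\mathcal A^*)=D(\mathcal B^*)=D^1_\xi\times D^2_\eta\times D^0_\xi\times D^0_\eta,$$ and, for $(A,B,C,D)\in\mathbb R^4$, $$\mathcal A^*(u_1,u_2,v_1,v_2)=(v_1,\;v_2,\;\Delta u_1-Au_1-Cu_2,\;-\Delta^2u_2-Bu_1-Du_2),$$ $$\mathcal B^*(u_1,u_2,v_1,v_2)=(u_1(\xi),u_2(\eta)).$$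 Assume that $\mathcal A^*$ is an operator in $\mathcal H'_{\xi,\eta}$ with this domain, i.e. that $\mathcal A^*U\in\mathcal H'_{\xi,\eta}$ for every $U\in D(\mathcal A^*)$ (for $B,C\ne0$ this means $D^2_\eta\subset D^{-1}_\xi$ and $D^1_\xi\subset D^{-2}_\eta$; it is automatic if $\xi=\eta$). Consider the observation problem $$U'=\mathcal A^*U,\quad U(0)=U_0,\quad \psi=\mathcal B^*U .$$ Then (H1) and (H3) below hold for all such $(A,B,C,D)$, and all of (H1)--(H4) hold for almost every such $(A,B,C,D)\in\mathbb R^4$ (with respect to Lebesgue measure). (H1) $\mathcal A^*$ generates a strongly continuous group $e^{t\mathcal A^*}$ of automorphisms of $\mathcal H'_{\xi,\eta}$. (H2) $D(\mathcal A^*)\subset D(\mathcal B^*)$, and there is a constant $c$ such that $\|\mathcal B^*U_0\|_{\mathcal G}\le c\,\|\mathcal A^*U_0\|_{\mathcal H'_{\xi,\eta}}$ for all $U_0\in D(\mathcal A^*)$. (H3) There are a non-degenerate bounded interval $I$ and a constant $c_I$ such that the solutions satisfy $\mathcal B^*U\in L^2(I;\mathcal G)$ and $\|\mathcal B^*U\|_{L^2(I;\mathcal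 G)}\le c_I\|U_0\|_{\mathcal H'_{\xi,\eta}}$ for all $U_0\in D(\mathcal A^*)$. (H4) There are a bounded interval $I'$ and a constant $c'>0$ such that the solutions satisfy $\mathcal B^*U\in L^2(I';\mathcal G)$ and $\|U_0\|_{\mathcal H'_{\xi,\eta}}\le c'\|\mathcal B^*U\|_{L^2(I';\mathcal G)}$ for all $U_0\in D(\mathcal A^*)$. -/

import Mathlib

open MeasureTheory Filter Topology

noncomputable section

namespace StringBeam

/-! ### The spaces `D^α_β` -/

/-- A point `β ∈ (0, π)` such that `β / π` is irrational. -/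
structure IrrPoint where
  val : ℝ
  mem_Ioo : val ∈ Set.Ioo 0 Real.pi
  irrational : Irrational (val / Real.pi)

/-- The weight `k ^ (2 α) * sin² (k β)` of the `k`-th sine coefficient in `D^α_β`. -/
def weight (α : ℝ) (β : IrrPoint) (k : ℕ+) : ℝ :=
  (k : ℝ) ^ (2 * α) * Real.sin (k * β.val) ^ 2

theorem sin_ne_zero (β : IrrPoint) (k : ℕ+) : Real.sin (k * β.val) ≠ 0 := by
  intro h
  obtain ⟨n, hn⟩ := Real.sin_eq_zero_iff.1 h
  have hk : (k : ℝ) ≠ 0 := by exact_mod_cast k.pos.ne'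
  apply β.irrational
  refine ⟨(n : ℚ) / (k : ℕ), ?_⟩
  have hpi := Real.pi_ne_zero
  push_cast
  field_simp
  linarith

theorem weight_pos (α : ℝ) (β : IrrPoint) (k : ℕ+) : 0 < weight α β k := by
  have hk : (0 : ℝ) < k := by exact_mod_cast k.pos
  have := sin_ne_zero β k
  unfold weight
  positivity

theorem weight_mono {α α' : ℝ} (h : α ≤ α') (β : IrrPoint) (k : ℕ+) :
    weight α β k ≤ weight α' β k := by
  have hk : (1 : ℝ) ≤ k := by exact_mod_cast k.pos
  unfold weight
  gcongr

theorem summable_weight_mul {α : ℝ} {β : IrrPoint} {a b : ℕ+ → ℝ}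
    (ha : Summable fun k => weight α β k * |a k| ^ 2)
    (hb : Summable fun k => weight α β k * |b k| ^ 2) :
    Summable fun k => weight α β k * (a k * b k) := by
  refine Summable.of_norm_bounded (ha.add hb) fun k => ?_
  have hw := weight_pos α β k
  rw [Real.norm_eq_abs, abs_mul, abs_mul, abs_of_pos hw]
  nlinarith [mul_nonneg hw.le (sq_nonneg (|a k| - |b k|)),
    mul_nonneg hw.le (mul_nonneg (abs_nonneg (a k)) (abs_nonneg (b k)))]

/-- The sequences of coefficients `(a_k)`, with respect to `w_k(x) = √(2/π) sin (k x)`, of the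
elements of `D^α_β`: those with `∑ k^(2α) sin²(k β) |a_k|² < ∞`. -/
def coeffs (α : ℝ) (β : IrrPoint) : Submodule ℝ (ℕ+ → ℝ) where
  carrier := {a | Summable fun k => weight α β k * |a k| ^ 2}
  zero_mem' := by simp
  add_mem' := by
    intro a b ha hb
    simp only [Set.mem_ofPred_eq] at *
    refine ((ha.add ((summable_weight_mul ha hb).mul_left 2)).add hb).congr fun k => ?_
    simp only [Pi.add_apply, sq_abs]
    ring
  smul_mem' := by
    intro c a ha
    simp only [Set.mem_ofPred_eq] at *
    refine (ha.mul_left (c ^ 2)).congr fun k => ?_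
    simp only [Pi.smul_apply, smul_eq_mul, sq_abs]
    ring

theorem mem_coeffs {α : ℝ} {β : IrrPoint} {a : ℕ+ → ℝ} :
    a ∈ coeffs α β ↔ Summable fun k => weight α β k * |a k| ^ 2 := Iff.rfl

theorem coeffs_anti {α α' : ℝ} (h : α ≤ α') (β : IrrPoint) : coeffs α' β ≤ coeffs α β := by
  intro a ha
  rw [mem_coeffs] at *
  refine Summable.of_nonneg_of_le (fun k => ?_) (fun k => ?_) ha
  · have := weight_pos α β k
    positivity
  · have := weight_mono h β k
    gcongr

/-- The Hilbert space `D^α_β`: the completion of the linear hull `Z` of the functions `w_k`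
for the norm `‖∑ a_k w_k‖² = ∑ k^(2α) sin²(k β) |a_k|²`. It is realised as the space of
the formal series `∑ a_k w_k` of finite norm; `DSpace.norm_sq_eq`, the `CompleteSpace` instance and
`DSpace.dense_Z` below say that this is the completion. -/
def DSpace (α : ℝ) (β : IrrPoint) : Type := coeffs α β

namespace DSpace

variable {α : ℝ} {β : IrrPoint}

instance : AddCommGroup (DSpace α β) := inferInstanceAs (AddCommGroup (coeffs α β))

instance : Module ℝ (DSpace α β) := inferInstanceAs (Module ℝ (coeffs α β))

/-- The sequence of coefficients `(a_k)` of `∑ a_k w_k`. -/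
def coeff : DSpace α β →ₗ[ℝ] (ℕ+ → ℝ) := (coeffs α β).subtype

/-- The element `∑ a_k w_k` with given coefficients. -/
def mk (a : ℕ+ → ℝ) (ha : a ∈ coeffs α β) : DSpace α β := ⟨a, ha⟩

@[simp] theorem coeff_mk (a : ℕ+ → ℝ) (ha : a ∈ coeffs α β) :
    coeff (mk a ha : DSpace α β) = a := rfl

theorem coeff_mem (u : DSpace α β) : coeff u ∈ coeffs α β := u.2

theorem coeff_injective : Function.Injective (coeff : DSpace α β → ℕ+ → ℝ) :=
  Subtype.val_injective

@[ext] theorem ext {u v : DSpace α β} (h : ∀ k, coeff u k = coeff v k) : u = v :=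
  coeff_injective (funext h)

theorem summable (u v : DSpace α β) :
    Summable fun k => weight α β k * (coeff u k * coeff v k) :=
  summable_weight_mul u.coeff_mem v.coeff_mem

/-- The inner product `∑ k^(2α) sin²(k β) a_k b_k`. -/
@[reducible] def core (α : ℝ) (β : IrrPoint) : InnerProductSpace.Core ℝ (DSpace α β) where
  inner u v := ∑' k, weight α β k * (coeff u k * coeff v k)
  conj_inner_symm u v := by
    simp only [conj_trivial]
    exact tsum_congr fun k => by ring
  re_inner_nonneg u := by
    refine tsum_nonneg fun k => ?_
    have := weight_pos α β k
    have := mul_self_nonneg (coeff u k)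
    positivity
  add_left u v w := by
    rw [← (summable u w).tsum_add (summable v w)]
    exact tsum_congr fun k => by simp only [map_add, Pi.add_apply]; ring
  smul_left u v c := by
    rw [← tsum_mul_left]
    exact tsum_congr fun k => by
      simp only [map_smul, Pi.smul_apply, smul_eq_mul, conj_trivial]; ring
  definite u hu := by
    have h0 : ∀ k, 0 ≤ weight α β k * (coeff u k * coeff u k) := fun k =>
      mul_nonneg (weight_pos α β k).le (mul_self_nonneg _)
    have h1 := (hasSum_zero_iff_of_nonneg h0).1 (hu ▸ (summable u u).hasSum)
    ext k
    have h2 := congrFun h1 k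
    simpa [(weight_pos α β k).ne'] using h2

instance : NormedAddCommGroup (DSpace α β) := (core α β).toNormedAddCommGroup

instance : InnerProductSpace ℝ (DSpace α β) := InnerProductSpace.ofCore (core α β).toCore

theorem norm_sq_eq (u : DSpace α β) : ‖u‖ ^ 2 = ∑' k, weight α β k * |coeff u k| ^ 2 := by
  rw [← real_inner_self_eq_norm_sq]
  change ∑' k, weight α β k * (coeff u k * coeff u k) = _
  exact tsum_congr fun k => by rw [sq_abs, sq]

/-- The isometry of `D^α_β` onto `ℓ²` given by `a_k ↦ k^α |sin (k β)| a_k`. -/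
def toEll2 (α : ℝ) (β : IrrPoint) : DSpace α β ≃ₗᵢ[ℝ] lp (fun _ : ℕ+ => ℝ) 2 where
  toFun u := ⟨fun k => √(weight α β k) * coeff u k, by
    refine (memℓp_gen_iff (by norm_num)).2 ?_
    refine u.coeff_mem.congr fun k => ?_
    have := Real.sq_sqrt (weight_pos α β k).le
    simp only [Real.norm_eq_abs, ENNReal.toReal_ofNat, Real.rpow_ofNat, sq_abs, mul_pow, this]⟩
  invFun x := mk (fun k => (√(weight α β k))⁻¹ * x k) (by
    have hx := (memℓp_gen_iff (by norm_num)).1 x.2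
    rw [mem_coeffs]
    refine hx.congr fun k => ?_
    have h := Real.sq_sqrt (weight_pos α β k).le
    have h' := (weight_pos α β k).ne'
    simp only [Real.norm_eq_abs, ENNReal.toReal_ofNat, Real.rpow_ofNat, sq_abs, mul_pow, inv_pow, h]
    field_simp)
  map_add' u v := by
    ext k
    simp only [map_add, Pi.add_apply, lp.coeFn_add]
    ring
  map_smul' c u := by
    ext k
    simp only [map_smul, Pi.smul_apply, lp.coeFn_smul, smul_eq_mul, RingHom.id_apply]
    ring
  left_inv u := by
    ext k
    have h' := (Real.sqrt_pos.2 (weight_pos α β k)).ne'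
    simp only [coeff_mk]
    field_simp
  right_inv x := by
    ext k
    have h' := (Real.sqrt_pos.2 (weight_pos α β k)).ne'
    simp only [coeff_mk]
    field_simp
  norm_map' u := by
    rw [← sq_eq_sq₀ (norm_nonneg _) (norm_nonneg _), norm_sq_eq,
      ← real_inner_self_eq_norm_sq, lp.inner_eq_tsum]
    refine tsum_congr fun k => ?_
    have h := Real.mul_self_sqrt (weight_pos α β k).le
    change (√(weight α β k) * coeff u k) * (√(weight α β k) * coeff u k) = _
    rw [sq_abs]
    linear_combination (coeff u k) ^ 2 * h

instance : CompleteSpace (DSpace α β) :=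
  (completeSpace_congr (e := (toEll2 α β).toEquiv) (toEll2 α β).isometry.isUniformEmbedding).2
    inferInstance

/-- The basis function `w_k`, as an element of `D^α_β`. -/
def basisFun (α : ℝ) (β : IrrPoint) (k : ℕ+) : DSpace α β :=
  mk (Pi.single k 1) (by
    refine summable_of_hasFiniteSupport ((Set.finite_singleton k).subset fun j hj => ?_)
    by_contra hjk
    simp at hj
    exact hjk hj.2)

theorem dense_Z (α : ℝ) (β : IrrPoint) :
    Dense (Submodule.span ℝ (Set.range (basisFun α β)) : Set (DSpace α β)) := by
  intro u
  have h := (lp.hasSum_single (by norm_num) (toEll2 α β u)).map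
    (toEll2 α β).symm.toLinearEquiv.toLinearMap (toEll2 α β).symm.continuous
  have h2 : (toEll2 α β).symm.toLinearEquiv.toLinearMap (toEll2 α β u) = u :=
    (toEll2 α β).symm_apply_apply u
  rw [h2] at h
  refine mem_closure_of_tendsto h (Eventually.of_forall fun s => ?_)
  refine Submodule.sum_mem _ fun k _ => ?_
  have h3 : (toEll2 α β).symm.toLinearEquiv.toLinearMap (lp.single 2 k (toEll2 α β u k))
      = coeff u k • basisFun α β k := by
    apply (toEll2 α β).injective
    change (toEll2 α β) ((toEll2 α β).symm _) = _
    rw [(toEll2 α β).apply_symm_apply]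
    ext j
    change (Pi.single k (√(weight α β k) * coeff u k) : ℕ+ → ℝ) j
      = √(weight α β j) * (coeff u k * (Pi.single k (1 : ℝ) : ℕ+ → ℝ) j)
    by_cases hj : j = k
    · subst hj; simp
    · simp [Pi.single_eq_of_ne hj]
  change (toEll2 α β).symm.toLinearEquiv.toLinearMap (lp.single 2 k (toEll2 α β u k)) ∈ _
  rw [h3]
  exact Submodule.smul_mem _ _ (Submodule.subset_span ⟨k, rfl⟩)

end DSpace

/-! ### The state space and the operators -/

/-- The Hilbert space `𝓗'_{ξ,η} = D^0_ξ × D^0_η × D^{-1}_ξ × D^{-2}_η`, with elements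
`U = (u₁, u₂, v₁, v₂)` bracketed as `((u₁, u₂), (v₁, v₂))`. -/
abbrev StateSpace (ξ η : IrrPoint) : Type :=
  WithLp 2 (WithLp 2 (DSpace 0 ξ × DSpace 0 η) × WithLp 2 (DSpace (-1) ξ × DSpace (-2) η))

section State

variable {ξ η : IrrPoint}

/-- Coefficients of `u₁`. -/
def u₁ : StateSpace ξ η →ₗ[ℝ] (ℕ+ → ℝ) where
  toFun U := DSpace.coeff U.fst.fst
  map_add' _ _ := map_add DSpace.coeff _ _
  map_smul' _ _ := map_smul DSpace.coeff _ _

/-- Coefficients of `u₂`. -/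
def u₂ : StateSpace ξ η →ₗ[ℝ] (ℕ+ → ℝ) where
  toFun U := DSpace.coeff U.fst.snd
  map_add' _ _ := map_add DSpace.coeff _ _
  map_smul' _ _ := map_smul DSpace.coeff _ _

/-- Coefficients of `v₁`. -/
def v₁ : StateSpace ξ η →ₗ[ℝ] (ℕ+ → ℝ) where
  toFun U := DSpace.coeff U.snd.fst
  map_add' _ _ := map_add DSpace.coeff _ _
  map_smul' _ _ := map_smul DSpace.coeff _ _

/-- Coefficients of `v₂`. -/
def v₂ : StateSpace ξ η →ₗ[ℝ] (ℕ+ → ℝ) where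
  toFun U := DSpace.coeff U.snd.snd
  map_add' _ _ := map_add DSpace.coeff _ _
  map_smul' _ _ := map_smul DSpace.coeff _ _

/-- The element of the state space with the given coefficients. -/
def mkState (a₁ a₂ b₁ b₂ : ℕ+ → ℝ) (ha₁ : a₁ ∈ coeffs 0 ξ) (ha₂ : a₂ ∈ coeffs 0 η)
    (hb₁ : b₁ ∈ coeffs (-1) ξ) (hb₂ : b₂ ∈ coeffs (-2) η) : StateSpace ξ η :=
  WithLp.toLp 2 (WithLp.toLp 2 (DSpace.mk a₁ ha₁, DSpace.mk a₂ ha₂),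
    WithLp.toLp 2 (DSpace.mk b₁ hb₁, DSpace.mk b₂ hb₂))

@[simp] theorem u₁_mkState {a₁ a₂ b₁ b₂ : ℕ+ → ℝ} (ha₁ : a₁ ∈ coeffs 0 ξ) (ha₂ : a₂ ∈ coeffs 0 η)
    (hb₁ : b₁ ∈ coeffs (-1) ξ) (hb₂ : b₂ ∈ coeffs (-2) η) :
    u₁ (mkState a₁ a₂ b₁ b₂ ha₁ ha₂ hb₁ hb₂) = a₁ := rfl

@[simp] theorem u₂_mkState {a₁ a₂ b₁ b₂ : ℕ+ → ℝ} (ha₁ : a₁ ∈ coeffs 0 ξ) (ha₂ : a₂ ∈ coeffs 0 η)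
    (hb₁ : b₁ ∈ coeffs (-1) ξ) (hb₂ : b₂ ∈ coeffs (-2) η) :
    u₂ (mkState a₁ a₂ b₁ b₂ ha₁ ha₂ hb₁ hb₂) = a₂ := rfl

@[simp] theorem v₁_mkState {a₁ a₂ b₁ b₂ : ℕ+ → ℝ} (ha₁ : a₁ ∈ coeffs 0 ξ) (ha₂ : a₂ ∈ coeffs 0 η)
    (hb₁ : b₁ ∈ coeffs (-1) ξ) (hb₂ : b₂ ∈ coeffs (-2) η) :
    v₁ (mkState a₁ a₂ b₁ b₂ ha₁ ha₂ hb₁ hb₂) = b₁ := rfl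

@[simp] theorem v₂_mkState {a₁ a₂ b₁ b₂ : ℕ+ → ℝ} (ha₁ : a₁ ∈ coeffs 0 ξ) (ha₂ : a₂ ∈ coeffs 0 η)
    (hb₁ : b₁ ∈ coeffs (-1) ξ) (hb₂ : b₂ ∈ coeffs (-2) η) :
    v₂ (mkState a₁ a₂ b₁ b₂ ha₁ ha₂ hb₁ hb₂) = b₂ := rfl

theorem state_ext {U V : StateSpace ξ η} (h₁ : u₁ U = u₁ V) (h₂ : u₂ U = u₂ V)
    (h₃ : v₁ U = v₁ V) (h₄ : v₂ U = v₂ V) : U = V := by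
  apply WithLp.ofLp_injective
  refine Prod.ext (WithLp.ofLp_injective _ (Prod.ext ?_ ?_))
    (WithLp.ofLp_injective _ (Prod.ext ?_ ?_))
  exacts [DSpace.coeff_injective h₁, DSpace.coeff_injective h₂, DSpace.coeff_injective h₃,
    DSpace.coeff_injective h₄]

end State

/-- The Laplacian `Δ = d²/dx²`, term by term in the sine series: `Δ w_k = -k² w_k`. -/
def lap : (ℕ+ → ℝ) →ₗ[ℝ] (ℕ+ → ℝ) where
  toFun a k := -(k : ℝ) ^ 2 * a k
  map_add' a b := by ext k; simp only [Pi.add_apply]; ring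
  map_smul' c a := by
    ext k; simp only [Pi.smul_apply, smul_eq_mul, RingHom.id_apply]; ring

/-- The third component `Δ u₁ - A u₁ - C u₂` of `𝒜* (u₁, u₂, v₁, v₂)`. -/
def stringForce (A C : ℝ) (a₁ a₂ : ℕ+ → ℝ) : ℕ+ → ℝ := lap a₁ - A • a₁ - C • a₂

/-- The fourth component `-Δ² u₂ - B u₁ - D u₂` of `𝒜* (u₁, u₂, v₁, v₂)`. -/
def beamForce (B D : ℝ) (a₁ a₂ : ℕ+ → ℝ) : ℕ+ → ℝ := -lap (lap a₂) - B • a₁ - D • a₂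

/-- `D(𝒜*) = D(ℬ*) = D^1_ξ × D^2_η × D^0_ξ × D^0_η`, as a subspace of `𝓗'_{ξ,η}`. -/
def dom (ξ η : IrrPoint) : Submodule ℝ (StateSpace ξ η) :=
  (coeffs 1 ξ).comap u₁ ⊓ (coeffs 2 η).comap u₂ ⊓ (coeffs 0 ξ).comap v₁ ⊓ (coeffs 0 η).comap v₂

theorem mem_dom {ξ η : IrrPoint} {U : StateSpace ξ η} :
    U ∈ dom ξ η ↔ ((u₁ U ∈ coeffs 1 ξ ∧ u₂ U ∈ coeffs 2 η) ∧ v₁ U ∈ coeffs 0 ξ) ∧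
      v₂ U ∈ coeffs 0 η := Iff.rfl

/-- `𝒜*` takes its values on `D(𝒜*)` in `𝓗'_{ξ,η}`, i.e. the formula for `𝒜*` defines an
operator in `𝓗'_{ξ,η}` with domain `D(𝒜*)`. (The first two components of `𝒜* U` always lie in
`D^0_ξ` and `D^0_η`.) -/
def MapsDomIntoState (A B C D : ℝ) (ξ η : IrrPoint) : Prop :=
  ∀ U ∈ dom ξ η, stringForce A C (u₁ U) (u₂ U) ∈ coeffs (-1) ξ ∧
    beamForce B D (u₁ U) (u₂ U) ∈ coeffs (-2) η

/-- `𝒜* (u₁, u₂, v₁, v₂) = (v₁, v₂, Δ u₁ - A u₁ - C u₂, -Δ² u₂ - B u₁ - D u₂)` as an unbounded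
operator in `𝓗'_{ξ,η}` with domain `D^1_ξ × D^2_η × D^0_ξ × D^0_η`. -/
def opA {A B C D : ℝ} {ξ η : IrrPoint} (h : MapsDomIntoState A B C D ξ η) :
    StateSpace ξ η →ₗ.[ℝ] StateSpace ξ η where
  domain := dom ξ η
  toFun :=
    { toFun := fun U => mkState (v₁ U.1) (v₂ U.1) (stringForce A C (u₁ U.1) (u₂ U.1))
        (beamForce B D (u₁ U.1) (u₂ U.1)) U.2.1.2 U.2.2 (h U.1 U.2).1 (h U.1 U.2).2
      map_add' := by
        intro U V
        apply state_ext
        · rw [map_add]; simp only [u₁_mkState, Submodule.coe_add, map_add]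
        · rw [map_add]; simp only [u₂_mkState, Submodule.coe_add, map_add]
        · rw [map_add]; simp only [v₁_mkState, Submodule.coe_add, map_add, stringForce, smul_add]
          abel
        · rw [map_add]; simp only [v₂_mkState, Submodule.coe_add, map_add, beamForce, smul_add]
          abel
      map_smul' := by
        intro c U
        apply state_ext
        · rw [map_smul]; simp only [u₁_mkState, Submodule.coe_smul, map_smul, RingHom.id_apply]
        · rw [map_smul]; simp only [u₂_mkState, Submodule.coe_smul, map_smul, RingHom.id_apply]
        · rw [map_smul]
          simp only [v₁_mkState, Submodule.coe_smul, map_smul, RingHom.id_apply, stringForce,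
            smul_sub, smul_comm c]
        · rw [map_smul]
          simp only [v₂_mkState, Submodule.coe_smul, map_smul, RingHom.id_apply, beamForce,
            smul_sub, smul_neg, smul_comm c] }

/-- `w_k(x) = √(2/π) sin (k x)`. -/
def w (k : ℕ+) (x : ℝ) : ℝ := √(2 / Real.pi) * Real.sin (k * x)

/-- The value at `x` of `∑ a_k w_k`. -/
def valueAt (x : ℝ) (a : ℕ+ → ℝ) : ℝ := ∑' k, a k * w k x

/-- The series for the point value at `β` converges absolutely on `D^1_β`. -/
theorem summable_valueAt {β : IrrPoint} {a : ℕ+ → ℝ} (ha : a ∈ coeffs 1 β) :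
    Summable fun k => a k * w k β.val := by
  have h1 : Summable fun k : ℕ+ => ((k : ℝ) ^ 2)⁻¹ :=
    (Real.summable_nat_pow_inv.2 (by norm_num : 1 < 2)).comp_injective
      (i := fun k : ℕ+ => (k : ℕ)) PNat.coe_injective
  refine Summable.of_norm_bounded ((h1.add (mem_coeffs.1 ha)).mul_left √(2 / Real.pi)) fun k => ?_
  have hk : (0 : ℝ) < k := by exact_mod_cast k.pos
  have hw : weight 1 β k = (k : ℝ) ^ 2 * Real.sin (k * β.val) ^ 2 := by
    simp [weight]
  have key : |a k| * |Real.sin (k * β.val)| ≤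
      ((k : ℝ) ^ 2)⁻¹ + (k : ℝ) ^ 2 * Real.sin (k * β.val) ^ 2 * |a k| ^ 2 := by
    have e : |a k| * |Real.sin (k * β.val)| =
        (k : ℝ)⁻¹ * ((k : ℝ) * |Real.sin (k * β.val)| * |a k|) := by
      field_simp
    rw [e, ← inv_pow, ← sq_abs (Real.sin _)]
    nlinarith [sq_nonneg ((k : ℝ)⁻¹ - (k : ℝ) * |Real.sin (k * β.val)| * |a k|),
      sq_nonneg ((k : ℝ)⁻¹), sq_nonneg ((k : ℝ) * |Real.sin (k * β.val)| * |a k|)]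
  rw [hw, w, Real.norm_eq_abs, abs_mul, abs_mul, abs_of_nonneg (Real.sqrt_nonneg _)]
  calc |a k| * (√(2 / Real.pi) * |Real.sin (k * β.val)|)
      = √(2 / Real.pi) * (|a k| * |Real.sin (k * β.val)|) := by ring
    _ ≤ _ := by gcongr

theorem valueAt_add {β : IrrPoint} {a b : ℕ+ → ℝ} (ha : a ∈ coeffs 1 β) (hb : b ∈ coeffs 1 β) :
    valueAt β.val (a + b) = valueAt β.val a + valueAt β.val b := by
  unfold valueAt
  rw [← (summable_valueAt ha).tsum_add (summable_valueAt hb)]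
  exact tsum_congr fun k => by simp only [Pi.add_apply]; ring

theorem valueAt_smul (x c : ℝ) (a : ℕ+ → ℝ) : valueAt x (c • a) = c * valueAt x a := by
  unfold valueAt
  rw [← tsum_mul_left]
  exact tsum_congr fun k => by simp only [Pi.smul_apply, smul_eq_mul]; ring

/-- `ℬ* (u₁, u₂, v₁, v₂) = (u₁(ξ), u₂(η))` as an operator from `𝓗'_{ξ,η}` to `𝒢 = ℝ²` with domain
`D^1_ξ × D^2_η × D^0_ξ × D^0_η`. -/
def opB (ξ η : IrrPoint) : StateSpace ξ η →ₗ.[ℝ] EuclideanSpace ℝ (Fin 2) where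
  domain := dom ξ η
  toFun :=
    { toFun := fun U => !₂[valueAt ξ.val (u₁ U.1), valueAt η.val (u₂ U.1)]
      map_add' := by
        intro U V
        have h₁ := valueAt_add U.2.1.1.1 V.2.1.1.1
        have h₂ := valueAt_add (coeffs_anti one_le_two η U.2.1.1.2)
          (coeffs_anti one_le_two η V.2.1.1.2)
        ext i
        fin_cases i
        · simpa using h₁
        · simpa using h₂
      map_smul' := by
        intro c U
        ext i
        fin_cases i
        · simp [valueAt_smul]
        · simp [valueAt_smul] }

/-! ### Strongly continuous groups, solutions, and the four hypotheses -/

section Abstract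

variable {X G : Type*} [NormedAddCommGroup X] [NormedSpace ℝ X]
  [NormedAddCommGroup G] [NormedSpace ℝ G]

/-- `S` is a strongly continuous group of bounded operators on `X`. -/
structure IsStronglyContinuousGroup (S : ℝ → X →L[ℝ] X) : Prop where
  map_zero : S 0 = ContinuousLinearMap.id ℝ X
  map_add : ∀ s t, S (s + t) = (S s).comp (S t)
  continuous : ∀ x, Continuous fun t => S t x

/-- `A` is the infinitesimal generator of `S`: `x ∈ D(A)` and `A x = y` if and only if
`(S t x - x) / t → y` as `t → 0`. -/
def IsGeneratorOf (A : X →ₗ.[ℝ] X) (S : ℝ → X →L[ℝ] X) : Prop :=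
  ∀ x y, (x, y) ∈ A.graph ↔ Tendsto (fun t : ℝ => t⁻¹ • (S t x - x)) (𝓝[≠] 0) (𝓝 y)

/-- `U` is a solution of `U' = A U` on `ℝ`, `U 0 = U₀`. -/
structure IsSolution (A : X →ₗ.[ℝ] X) (U₀ : X) (U : ℝ → X) : Prop where
  init : U 0 = U₀
  mem : ∀ t, U t ∈ A.domain
  hasDerivAt : ∀ t, HasDerivAt U (A ⟨U t, mem t⟩) t

/-- The norm of `f` in `L²(a, b; G)`, for `f` in that space. -/
def L2norm (a b : ℝ) (f : ℝ → G) : ℝ := √(∫ t in Set.Icc a b, ‖f t‖ ^ 2)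

/-- `A` generates a strongly continuous group. -/
def HypH1 (A : X →ₗ.[ℝ] X) : Prop :=
  ∃ S : ℝ → X →L[ℝ] X, IsStronglyContinuousGroup S ∧ IsGeneratorOf A S

/-- `D(A) ⊆ D(B)` and `‖B U₀‖ ≤ c ‖A U₀‖` for all `U₀ ∈ D(A)`. -/
def HypH2 (A : X →ₗ.[ℝ] X) (B : X →ₗ.[ℝ] G) : Prop :=
  ∃ hAB : A.domain ≤ B.domain, ∃ c : ℝ,
    ∀ U₀ : A.domain, ‖B ⟨U₀.1, hAB U₀.2⟩‖ ≤ c * ‖A U₀‖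

/-- Direct inequality: `‖B U‖_{L²(I; G)} ≤ c ‖U₀‖` for the solutions with `U₀ ∈ D(A)`, for some
non-degenerate bounded interval `I`. -/
def HypH3 (A : X →ₗ.[ℝ] X) (B : X →ₗ.[ℝ] G) : Prop :=
  ∃ hAB : A.domain ≤ B.domain, ∃ a b c : ℝ, a < b ∧
    ∀ U₀ ∈ A.domain, ∀ U : ℝ → X, ∀ hU : IsSolution A U₀ U,
      MemLp (fun t => B ⟨U t, hAB (hU.mem t)⟩) 2 (volume.restrict (Set.Icc a b)) ∧
      L2norm a b (fun t => B ⟨U t, hAB (hU.mem t)⟩) ≤ c * ‖U₀‖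

/-- Inverse inequality: `‖U₀‖ ≤ c' ‖B U‖_{L²(I'; G)}` for the solutions with `U₀ ∈ D(A)`, for some
bounded interval `I'` and some `c' > 0`. -/
def HypH4 (A : X →ₗ.[ℝ] X) (B : X →ₗ.[ℝ] G) : Prop :=
  ∃ hAB : A.domain ≤ B.domain, ∃ a b c' : ℝ, a < b ∧ 0 < c' ∧
    ∀ U₀ ∈ A.domain, ∀ U : ℝ → X, ∀ hU : IsSolution A U₀ U,
      MemLp (fun t => B ⟨U t, hAB (hU.mem t)⟩) 2 (volume.restrict (Set.Icc a b)) ∧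
      ‖U₀‖ ≤ c' * L2norm a b (fun t => B ⟨U t, hAB (hU.mem t)⟩)

end Abstract

end StringBeam

end

/-!
Multiplying the `k`-th coefficients of a state by the square roots of their weights identifies
`StateSpace ξ η` isometrically with `ℓ²(ℕ+, ℝ⁴)` and turns `𝒜*` into a direct sum of `4 × 4` blocks:
two oscillators of frequencies `k` and `k ^ 2`, shifted by `A` and `D` and coupled by numbers whose
product is `B * C`. That `𝒜*` maps its domain into the state space forces the couplings to
grow slowly enough for the flows of the blocks to be uniformly bounded, which gives (H1).

The high blocks are `O(1 / k)`-close to two free rotations. On `[0, 2πm]` the observations of these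
rotations are explicitly orthogonal, which gives the direct inequality (H3) and, for large `m`, the
inverse inequality for data without low blocks. Compactness reduces (H4) to excluding unobservable
data. Such data form an invariant space on which the generator acts, so that applying polynomials
in the generator isolates a single block; when no two blocks share an eigenvalue and no block is
singular, a single block is observable. Finally (H2) is Cramer's rule in each block, and the
parameters violating the genericity conditions lie on countably many null sets.
-/

noncomputable section

namespace StringBeam

local notation "ℓ²(" ι ", " E ")" => lp (fun _ : ι => E) 2

/-! ### Block-diagonal groups on `ℓ²` -/

section Ell2

variable {ι E : Type*} [NormedAddCommGroup E]

theorem ell2_summable_norm_sq (z : ℓ²(ι, E)) : Summable fun k => ‖z k‖ ^ 2 := by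
  simpa using (lp.memℓp z).summable (by norm_num)

theorem ell2_norm_sq (z : ℓ²(ι, E)) : ‖z‖ ^ 2 = ∑' k, ‖z k‖ ^ 2 := by
  simpa using lp.norm_rpow_eq_tsum (by norm_num) z

theorem memℓp_two_of_summable {f : ι → E} (h : Summable fun k => ‖f k‖ ^ 2) : Memℓp f 2 :=
  (memℓp_gen_iff (by norm_num)).2 (by simpa using h)

theorem ell2_tendsto_of_dominated {τ : Type*} {l : Filter τ} {f : τ → ℓ²(ι, E)} {g : ℓ²(ι, E)}
    {b : ι → ℝ} (hb : Summable fun k => b k ^ 2)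
    (hfg : ∀ k, Tendsto (fun t => f t k) l (𝓝 (g k)))
    (hle : ∀ᶠ t in l, ∀ k, ‖f t k - g k‖ ≤ b k) : Tendsto f l (𝓝 g) := by
  have h_sum : Tendsto (fun t => ∑' k, ‖f t k - g k‖ ^ 2) l (𝓝 (∑' _ : ι, (0 : ℝ))) := by
    refine tendsto_tsum_of_dominated_convergence hb (fun k => ?_) ?_
    · simpa using (tendsto_iff_norm_sub_tendsto_zero.1 (hfg k)).pow 2
    · filter_upwards [hle] with t ht k
      rw [Real.norm_of_nonneg (by positivity)]
      exact pow_le_pow_left₀ (norm_nonneg _) (ht k) 2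
  rw [tendsto_iff_norm_sub_tendsto_zero]
  have h_sqrt := h_sum.sqrt
  rw [tsum_zero, Real.sqrt_zero] at h_sqrt
  refine h_sqrt.congr fun t => ?_
  rw [← Real.sqrt_sq (norm_nonneg (f t - g)), ell2_norm_sq]
  rfl

end Ell2

section BlockOp

variable {ι E F : Type*} [NormedAddCommGroup E] [NormedSpace ℝ E]
  [NormedAddCommGroup F] [NormedSpace ℝ F]

/-- The block-diagonal operator on `ℓ²` with uniformly bounded blocks `T k`. -/
def blockOp (T : ι → E →L[ℝ] F) (hT : ∃ C, ∀ k, ‖T k‖ ≤ C) : ℓ²(ι, E) →L[ℝ] ℓ²(ι, F) :=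
  have h_le (z : ℓ²(ι, E)) (k : ι) : ‖T k (z k)‖ ≤ ‖(max hT.choose 0 • z) k‖ := by
    rw [lp.coeFn_smul, Pi.smul_apply, norm_smul, Real.norm_of_nonneg (le_max_right _ _)]
    exact (T k).le_of_opNorm_le ((hT.choose_spec k).trans (le_max_left _ _)) _
  LinearMap.mkContinuous
    { toFun := fun z => ⟨fun k => T k (z k), (lp.memℓp _).mono' (h_le z)⟩
      map_add' := fun x y => by ext k; exact map_add (T k) _ _
      map_smul' := fun c x => by ext k; exact map_smul (T k) _ _ }
    (max hT.choose 0) fun z => by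
      refine (lp.norm_mono two_ne_zero (h_le z)).trans_eq ?_
      rw [norm_smul, Real.norm_of_nonneg (le_max_right _ _)]

end BlockOp

section Flow

variable {E : Type*} [NormedAddCommGroup E] [NormedSpace ℝ E]

/-- The flow `e^{tM}` of the linear equation `z' = M z`. -/
def flow (M : E →L[ℝ] E) (t : ℝ) : E →L[ℝ] E := NormedSpace.exp (t • M)

@[simp] theorem flow_zero (M : E →L[ℝ] E) : flow M 0 = ContinuousLinearMap.id ℝ E := by
  simp [flow, NormedSpace.exp_zero, ContinuousLinearMap.one_def]

variable [CompleteSpace E]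

theorem flow_add (M : E →L[ℝ] E) (s t : ℝ) : flow M (s + t) = (flow M s).comp (flow M t) := by
  unfold flow
  let _ : NormedAlgebra ℚ (E →L[ℝ] E) := NormedAlgebra.restrictScalars ℚ ℝ _
  rw [add_smul, NormedSpace.exp_add_of_commute (((Commute.refl M).smul_left s).smul_right t)]
  rfl

theorem flow_flow_neg (M : E →L[ℝ] E) (t : ℝ) (z : E) : flow M t (flow M (-t) z) = z := by
  rw [← ContinuousLinearMap.comp_apply, ← flow_add, add_neg_cancel, flow_zero,
    ContinuousLinearMap.id_apply]

theorem hasDerivAt_flow (M : E →L[ℝ] E) (t : ℝ) : HasDerivAt (flow M) (flow M t * M) t :=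
  hasDerivAt_exp_smul_const M t

theorem hasDerivAt_flow_apply (M : E →L[ℝ] E) (z : E) (t : ℝ) :
    HasDerivAt (fun t => flow M t z) (M (flow M t z)) t :=
  (hasDerivAt_exp_smul_const' M t).clm_apply (hasDerivAt_const t z) |>.congr_deriv (by simp [flow])

theorem hasDerivAt_flow_apply' (M : E →L[ℝ] E) (z : E) (t : ℝ) :
    HasDerivAt (fun t => flow M t z) (flow M t (M z)) t :=
  (hasDerivAt_flow M t).clm_apply (hasDerivAt_const t z) |>.congr_deriv (by simp)

theorem continuous_flow (M : E →L[ℝ] E) : Continuous (flow M) :=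
  continuous_iff_continuousAt.2 fun t => (hasDerivAt_flow M t).continuousAt

theorem continuous_flow_apply (M : E →L[ℝ] E) (z : E) : Continuous fun t => flow M t z :=
  (continuous_flow M).clm_apply continuous_const

theorem eq_flow_of_hasDerivAt {M : E →L[ℝ] E} {z : ℝ → E}
    (hz : ∀ t, HasDerivAt z (M (z t)) t) (t : ℝ) : z t = flow M t (z 0) := by
  have h_deriv : ∀ t, HasDerivAt (fun t => flow M (-t) (z t)) 0 t := by
    intro t
    have h_flow : HasDerivAt (fun t : ℝ => flow M (-t)) (-(flow M (-t) * M)) t := by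
      simpa [Function.comp_def] using (hasDerivAt_flow M (-t)).scomp t (hasDerivAt_neg t)
    exact (h_flow.clm_apply (hz t)).congr_deriv (by simp)
  have h_const : flow M (-t) (z t) = flow M (-0) (z 0) :=
    is_const_of_deriv_eq_zero (fun t => (h_deriv t).differentiableAt) (fun t => (h_deriv t).deriv)
      t 0
  rw [← flow_flow_neg M t (z t), h_const, neg_zero, flow_zero, ContinuousLinearMap.id_apply]

theorem exists_norm_flow_le (M : E →L[ℝ] E) (T : ℝ) : ∃ C, ∀ t, |t| ≤ T → ‖flow M t‖ ≤ C := by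
  obtain ⟨C, hC⟩ := (isCompact_Icc (a := -T) (b := T)).exists_bound_of_continuousOn
    (continuous_flow M).continuousOn
  exact ⟨C, fun t ht => hC t (abs_le.1 ht)⟩

theorem norm_slope_flow_sub_le {M : E →L[ℝ] E} {C t : ℝ} (hC : ∀ s, |s| ≤ 1 → ‖flow M s‖ ≤ C)
    (ht : |t| ≤ 1) (ht₀ : t ≠ 0) (x : E) :
    ‖t⁻¹ • (flow M t x - x) - M x‖ ≤ (C + 1) * ‖M x‖ := by
  have h_mean : ‖flow M t x - flow M 0 x‖ ≤ (C * ‖M x‖) * ‖t - 0‖ :=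
    Convex.norm_image_sub_le_of_norm_hasDerivWithin_le
      (fun s _ => (hasDerivAt_flow_apply' M x s).hasDerivWithinAt)
      (fun s hs => (flow M s).le_of_opNorm_le (hC s (abs_le.2 hs)) _)
      (convex_Icc (-1 : ℝ) 1) (by constructor <;> norm_num) (abs_le.1 ht)
  simp only [flow_zero, ContinuousLinearMap.id_apply, sub_zero, Real.norm_eq_abs] at h_mean
  have h_slope : ‖t⁻¹ • (flow M t x - x)‖ ≤ C * ‖M x‖ := by
    rw [norm_smul, norm_inv, Real.norm_eq_abs, inv_mul_le_iff₀ (abs_pos.2 ht₀)]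
    linarith
  linarith [norm_sub_le (t⁻¹ • (flow M t x - x)) (M x)]

end Flow

section BlockGroup

variable {ι E : Type*} [NormedAddCommGroup E] [NormedSpace ℝ E]
  {M : ι → E →L[ℝ] E}

/-- The flows of the blocks `M k` are bounded uniformly in `k`, locally uniformly in time. -/
def FlowBounded (M : ι → E →L[ℝ] E) : Prop :=
  ∀ T : ℝ, ∃ C, ∀ k t, |t| ≤ T → ‖flow (M k) t‖ ≤ C

theorem FlowBounded.exists_bound (hM : FlowBounded M) (t : ℝ) : ∃ C, ∀ k, ‖flow (M k) t‖ ≤ C :=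
  (hM |t|).imp fun _ hC k => hC k t le_rfl

/-- The block-diagonal group `e^{tM}` on `ℓ²`. -/
def blockGroup (hM : FlowBounded M) (t : ℝ) : ℓ²(ι, E) →L[ℝ] ℓ²(ι, E) :=
  blockOp (fun k => flow (M k) t) (hM.exists_bound t)

@[simp] theorem blockGroup_apply (hM : FlowBounded M) (t : ℝ) (z : ℓ²(ι, E)) (k : ι) :
    blockGroup hM t z k = flow (M k) t (z k) := rfl

variable [CompleteSpace E]

theorem flowBounded_of_forall_notMem {L : Set ι} (hL : L.Finite)
    (h : ∀ T : ℝ, ∃ C, ∀ k ∉ L, ∀ t, |t| ≤ T → ‖flow (M k) t‖ ≤ C) : FlowBounded M := by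
  intro T
  obtain ⟨C, hC⟩ := h T
  choose C' hC' using fun k => exists_norm_flow_le (M k) T
  obtain ⟨B, hB⟩ := (hL.image C').bddAbove
  refine ⟨max C B, fun k t ht => ?_⟩
  by_cases hk : k ∈ L
  · exact (hC' k t ht).trans ((hB (Set.mem_image_of_mem _ hk)).trans (le_max_right _ _))
  · exact (hC k hk t ht).trans (le_max_left _ _)

theorem continuous_blockGroup_apply (hM : FlowBounded M) (z : ℓ²(ι, E)) :
    Continuous fun t => blockGroup hM t z := by
  refine continuous_iff_continuousAt.2 fun t => ?_
  obtain ⟨C, hC⟩ := hM (|t| + 1)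
  refine ell2_tendsto_of_dominated (f := fun t => blockGroup hM t z) (g := blockGroup hM t z)
    (b := fun k => (2 * C) * ‖z k‖) ?_ (fun k => ?_) ?_
  · exact ((ell2_summable_norm_sq z).mul_left ((2 * C) ^ 2)).congr fun k => (mul_pow _ _ _).symm
  · simp only [blockGroup_apply]
    exact (continuous_flow_apply (M k) (z k)).continuousAt
  · filter_upwards [Metric.ball_mem_nhds t one_pos] with s hs k
    have hs' : |s| ≤ |t| + 1 := by
      rw [Metric.mem_ball, Real.dist_eq] at hs
      linarith [abs_sub_abs_le_abs_sub s t]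
    have h_s := (flow (M k) s).le_of_opNorm_le (hC k s hs') (z k)
    have h_t := (flow (M k) t).le_of_opNorm_le (hC k t (by linarith)) (z k)
    simp only [blockGroup_apply]
    linarith [norm_sub_le (flow (M k) s (z k)) (flow (M k) t (z k))]

theorem isStronglyContinuousGroup_blockGroup (hM : FlowBounded M) :
    IsStronglyContinuousGroup (blockGroup hM) where
  map_zero := by ext z k; simp
  map_add s t := by ext z k; simp [flow_add]
  continuous := continuous_blockGroup_apply hM

theorem tendsto_slope_blockGroup_iff (hM : FlowBounded M) (x y : ℓ²(ι, E)) :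
    Tendsto (fun t : ℝ => t⁻¹ • (blockGroup hM t x - x)) (𝓝[≠] 0) (𝓝 y) ↔
      ∀ k, M k (x k) = y k := by
  have h_block : ∀ k, Tendsto (fun t : ℝ => t⁻¹ • (flow (M k) t (x k) - x k)) (𝓝[≠] 0)
      (𝓝 (M k (x k))) := fun k => by
    simpa using (hasDerivAt_flow_apply (M k) (x k) 0).tendsto_slope_zero
  refine ⟨fun h k => tendsto_nhds_unique (h_block k)
    (((lp.evalCLM ℝ (fun _ : ι => E) 2 k).continuous.tendsto y).comp h), fun h => ?_⟩
  obtain ⟨C, hC⟩ := hM 1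
  refine ell2_tendsto_of_dominated (b := fun k => (C + 1) * ‖y k‖) ?_ (fun k => h k ▸ h_block k) ?_
  · exact ((ell2_summable_norm_sq y).mul_left ((C + 1) ^ 2)).congr fun k => (mul_pow _ _ _).symm
  · filter_upwards [mem_nhdsWithin_of_mem_nhds (Metric.ball_mem_nhds (0 : ℝ) one_pos),
      self_mem_nhdsWithin] with t ht ht₀ k
    rw [Metric.mem_ball, Real.dist_eq, sub_zero] at ht
    rw [← h k]
    exact norm_slope_flow_sub_le (hC k) ht.le ht₀ (x k)

end BlockGroup

/-! ### Observation of block-diagonal groups -/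

section Synthesis

variable {ι E F : Type*} [NormedAddCommGroup E] [NormedSpace ℝ E]
  [NormedAddCommGroup F] [NormedSpace ℝ F] {T : ι → E →L[ℝ] F}

/-- The Bessel inequality for the family `T`: the synthesis `z ↦ ∑ k, T k (z k)` is bounded from
`ℓ²` to `F`, uniformly over the finite partial sums. -/
def IsBessel (T : ι → E →L[ℝ] F) : Prop :=
  ∃ C : ℝ, 0 ≤ C ∧ ∀ (s : Finset ι) (z : ι → E),
    ‖∑ k ∈ s, T k (z k)‖ ≤ C * √(∑ k ∈ s, ‖z k‖ ^ 2)

theorem norm_sum_apply_inter_le [DecidableEq ι] (T : ι → E →L[ℝ] F) (s L : Finset ι) (z : ι → E) :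
    ‖∑ k ∈ s ∩ L, T k (z k)‖ ≤ (∑ k ∈ L, ‖T k‖) * √(∑ k ∈ s, ‖z k‖ ^ 2) := by
  have h_term : ∀ k ∈ s ∩ L, ‖T k (z k)‖ ≤ ‖T k‖ * √(∑ k ∈ s, ‖z k‖ ^ 2) := by
    refine fun k hk => (T k).le_opNorm_of_le (Real.le_sqrt_of_sq_le ?_)
    exact Finset.single_le_sum (f := fun k => ‖z k‖ ^ 2) (fun _ _ => by positivity)
      (Finset.mem_of_mem_inter_left hk)
  calc ‖∑ k ∈ s ∩ L, T k (z k)‖ ≤ ∑ k ∈ s ∩ L, ‖T k‖ * √(∑ k ∈ s, ‖z k‖ ^ 2) :=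
        norm_sum_le_of_le _ h_term
    _ ≤ ∑ k ∈ L, ‖T k‖ * √(∑ k ∈ s, ‖z k‖ ^ 2) :=
        Finset.sum_le_sum_of_subset_of_nonneg Finset.inter_subset_right fun _ _ _ => by positivity
    _ = (∑ k ∈ L, ‖T k‖) * √(∑ k ∈ s, ‖z k‖ ^ 2) := (Finset.sum_mul ..).symm

theorem isBessel_of_disjoint (L : Finset ι) {C : ℝ} (hC₀ : 0 ≤ C)
    (hC : ∀ s : Finset ι, Disjoint s L → ∀ z : ι → E,
      ‖∑ k ∈ s, T k (z k)‖ ≤ C * √(∑ k ∈ s, ‖z k‖ ^ 2)) : IsBessel T := by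
  classical
  refine ⟨∑ k ∈ L, ‖T k‖ + C, by positivity, fun s z => ?_⟩
  rw [← Finset.sum_inter_add_sum_sdiff s L, add_mul]
  refine (norm_add_le _ _).trans (add_le_add (norm_sum_apply_inter_le T s L z)
    ((hC _ Finset.sdiff_disjoint z).trans ?_))
  gcongr
  exact Finset.sdiff_subset

variable [CompleteSpace F]

theorem IsBessel.summable (h : IsBessel T) (z : ℓ²(ι, E)) : Summable fun k => T k (z k) := by
  obtain ⟨C, hC₀, hC⟩ := h
  rw [summable_iff_vanishing_norm]
  intro ε hε
  have hδ : 0 < ε / (C + 1) := by positivity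
  obtain ⟨s, hs⟩ := (summable_iff_vanishing_norm.1 (ell2_summable_norm_sq z)) _ (pow_pos hδ 2)
  refine ⟨s, fun t ht => (hC t _).trans_lt ?_⟩
  have h_tail : √(∑ k ∈ t, ‖z k‖ ^ 2) < ε / (C + 1) :=
    (Real.sqrt_lt' hδ).2 ((Real.le_norm_self _).trans_lt (hs t ht))
  calc C * √(∑ k ∈ t, ‖z k‖ ^ 2) ≤ C * (ε / (C + 1)) := by gcongr
    _ < (C + 1) * (ε / (C + 1)) := by gcongr; exact lt_add_one C
    _ = ε := by field_simp

/-- The synthesis operator `z ↦ ∑' k, T k (z k)` of a family satisfying the Bessel inequality. -/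
def synthesis (h : IsBessel T) : ℓ²(ι, E) →L[ℝ] F :=
  LinearMap.mkContinuous
    { toFun := fun z => ∑' k, T k (z k)
      map_add' := fun x y => by
        rw [← (h.summable x).tsum_add (h.summable y)]
        exact tsum_congr fun k => map_add (T k) _ _
      map_smul' := fun c x => by
        rw [RingHom.id_apply, ← (h.summable x).tsum_const_smul c]
        exact tsum_congr fun k => map_smul (T k) _ _ } h.choose (fun z => by
      refine le_of_tendsto (h.summable z).hasSum.norm (Eventually.of_forall fun s => ?_)
      refine (h.choose_spec.2 s _).trans (mul_le_mul_of_nonneg_left ?_ h.choose_spec.1)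
      refine Real.sqrt_le_iff.2 ⟨norm_nonneg _, ?_⟩
      rw [ell2_norm_sq]
      exact (ell2_summable_norm_sq z).sum_le_tsum s fun k _ => by positivity)

theorem hasSum_synthesis (h : IsBessel T) (z : ℓ²(ι, E)) :
    HasSum (fun k => T k (z k)) (synthesis h z) := (h.summable z).hasSum

theorem synthesis_single [DecidableEq ι] (h : IsBessel T) (k : ι) (x : E) :
    synthesis h (lp.single 2 k x) = T k x := by
  set z : ℓ²(ι, E) := lp.single 2 k x with hz
  have h_single : HasSum (fun j => T j (z j)) (T k (z k)) := hasSum_single k fun j hj => by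
    rw [hz, lp.single_apply_ne _ _ _ hj, map_zero]
  rw [(hasSum_synthesis h z).unique h_single, hz, lp.single_apply_self]

end Synthesis

section ToL2

variable {G : Type*} [NormedAddCommGroup G]

theorem memLp_Icc_of_continuous (T : ℝ) {f : ℝ → G} (hf : Continuous f) :
    MemLp f 2 (volume.restrict (Set.Icc 0 T)) := by
  obtain ⟨C, hC⟩ := (isCompact_Icc (a := 0) (b := T)).exists_bound_of_continuousOn hf.continuousOn
  exact MemLp.of_bound hf.aestronglyMeasurable C (ae_restrict_of_forall_mem measurableSet_Icc hC)

variable [NormedSpace ℝ G]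

/-- The class of a continuous function in `L²(0, T; G)`. -/
def toL2 (T : ℝ) : C(ℝ, G) →ₗ[ℝ] Lp G 2 (volume.restrict (Set.Icc 0 T)) where
  toFun f := (memLp_Icc_of_continuous T f.continuous).toLp f
  map_add' _ _ := rfl
  map_smul' _ _ := rfl

theorem coeFn_toL2 (T : ℝ) (f : C(ℝ, G)) : toL2 T f =ᵐ[volume.restrict (Set.Icc 0 T)] f :=
  (memLp_Icc_of_continuous T f.continuous).coeFn_toLp

theorem norm_toL2_sq (T : ℝ) (f : C(ℝ, G)) :
    ‖toL2 T f‖ ^ 2 = ∫ t in Set.Icc 0 T, ‖f t‖ ^ 2 := by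
  have hf := memLp_Icc_of_continuous T f.continuous
  change ‖hf.toLp f‖ ^ 2 = _
  have h_nonneg : 0 ≤ ∫ t in Set.Icc 0 T, ‖f t‖ ^ 2 := by positivity
  rw [Lp.norm_toLp, hf.eLpNorm_eq_integral_rpow_norm two_ne_zero ENNReal.ofNat_ne_top]
  simp only [ENNReal.toReal_ofNat, Real.rpow_ofNat]
  rw [ENNReal.toReal_ofReal (by positivity), ← Real.rpow_mul_natCast h_nonneg]
  norm_num

theorem norm_toL2_le_of_forall {T c : ℝ} (hT : 0 ≤ T) (hc : 0 ≤ c) {f : C(ℝ, G)}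
    (h : ∀ t ∈ Set.Icc 0 T, ‖f t‖ ≤ c) : ‖toL2 T f‖ ≤ √T * c := by
  refine le_of_sq_le_sq ?_ (by positivity)
  have h_int : ∫ t in Set.Icc 0 T, ‖f t‖ ^ 2 ≤ ∫ _ in Set.Icc 0 T, c ^ 2 := by
    refine setIntegral_mono_on ?_ continuousOn_const.integrableOn_Icc measurableSet_Icc
      fun t ht => pow_le_pow_left₀ (norm_nonneg _) (h t ht) 2
    exact (by fun_prop : Continuous fun t => ‖f t‖ ^ 2).continuousOn.integrableOn_Icc
  rw [norm_toL2_sq, mul_pow, Real.sq_sqrt hT]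
  simpa [hT] using h_int

theorem norm_toL2_comp_addRight_le {T₀ T τ : ℝ} (hτ : 0 ≤ τ) (hT : τ + T₀ ≤ T) (f : C(ℝ, G)) :
    ‖toL2 T₀ (f.comp (ContinuousMap.addRight τ))‖ ≤ ‖toL2 T f‖ := by
  refine le_of_sq_le_sq ?_ (norm_nonneg _)
  have h_preserving : MeasurePreserving (fun t : ℝ => t + τ)
      (volume.restrict (Set.Icc 0 T₀)) (volume.restrict (Set.Icc τ (τ + T₀))) := by
    simpa using (measurePreserving_add_right volume τ).restrict_preimage
      (measurableSet_Icc (a := τ) (b := τ + T₀))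
  calc ‖toL2 T₀ (f.comp (ContinuousMap.addRight τ))‖ ^ 2
      = ∫ t in Set.Icc τ (τ + T₀), ‖f t‖ ^ 2 := by
        rw [norm_toL2_sq]
        exact h_preserving.integral_comp (measurableEmbedding_addRight τ) fun t => ‖f t‖ ^ 2
    _ ≤ ∫ t in Set.Icc 0 T, ‖f t‖ ^ 2 := by
        refine setIntegral_mono_set ?_ (Eventually.of_forall fun t => by positivity)
          (Set.Icc_subset_Icc hτ hT).eventuallyLE
        exact (by fun_prop : Continuous fun t => ‖f t‖ ^ 2).continuousOn.integrableOn_Icc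
    _ = ‖toL2 T f‖ ^ 2 := (norm_toL2_sq T f).symm

theorem eqOn_zero_of_toL2_eq_zero {T : ℝ} (hT : 0 < T) {f : C(ℝ, G)} (h : toL2 T f = 0) :
    Set.EqOn f 0 (Set.Icc 0 T) := by
  have h_ae : f =ᵐ[volume.restrict (Set.Ioo 0 T)] (0 : ℝ → G) := by
    rw [Measure.restrict_congr_set Ioo_ae_eq_Icc]
    exact (coeFn_toL2 T f).symm.trans (h ▸ Lp.coeFn_zero _ _ _)
  rw [← closure_Ioo hT.ne]
  exact (Measure.eqOn_open_of_ae_eq h_ae isOpen_Ioo f.continuous.continuousOn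
    continuousOn_const).closure f.continuous continuous_const

end ToL2

section Observation

variable {ι E G : Type*} [NormedAddCommGroup E] [NormedSpace ℝ E] [CompleteSpace E]
  [NormedAddCommGroup G] [NormedSpace ℝ G]

/-- The observation `t ↦ P (e^{tM} z)`. -/
def obsFun (P : E →L[ℝ] G) (M : E →L[ℝ] E) : E →ₗ[ℝ] C(ℝ, G) where
  toFun z := ⟨fun t => P (flow M t z), P.continuous.comp (continuous_flow_apply M z)⟩
  map_add' x y := by ext t; simp
  map_smul' c x := by ext t; simp

@[simp] theorem obsFun_apply (P : E →L[ℝ] G) (M : E →L[ℝ] E) (z : E) (t : ℝ) :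
    obsFun P M z t = P (flow M t z) := rfl

variable [FiniteDimensional ℝ E]

/-- The observation of one block, as a map into `L²(0, T; G)`. -/
def obsBlock (P : E →L[ℝ] G) (T : ℝ) (M : E →L[ℝ] E) :
    E →L[ℝ] Lp G 2 (volume.restrict (Set.Icc 0 T)) :=
  LinearMap.toContinuousLinearMap ((toL2 T).comp (obsFun P M))

theorem sum_obsBlock (P : E →L[ℝ] G) (T : ℝ) (M : ι → E →L[ℝ] E) (s : Finset ι) (z : ι → E) :
    ∑ k ∈ s, obsBlock P T (M k) (z k) = toL2 T (∑ k ∈ s, obsFun P (M k) (z k)) :=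
  (map_sum (toL2 T) _ s).symm

/-- The observations in `L²(0, T; G)` of the blocks `M k` satisfy the Bessel inequality. -/
def Admissible (P : E →L[ℝ] G) (T : ℝ) (M : ι → E →L[ℝ] E) : Prop :=
  IsBessel fun k => obsBlock P T (M k)

variable [CompleteSpace G] {P : E →L[ℝ] G} {M : ι → E →L[ℝ] E} {T : ℝ}

/-- The observation operator of the block-diagonal group from `ℓ²` to `L²(0, T; G)`. -/
def obs (h : Admissible P T M) : ℓ²(ι, E) →L[ℝ] Lp G 2 (volume.restrict (Set.Icc 0 T)) :=
  synthesis h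

theorem hasSum_obs (h : Admissible P T M) (z : ℓ²(ι, E)) :
    HasSum (fun k => obsBlock P T (M k) (z k)) (obs h z) := hasSum_synthesis h z

theorem obs_ae_eq [Countable ι] (h : Admissible P T M) (z : ℓ²(ι, E)) {f : ℝ → G}
    (hf : ∀ t, HasSum (fun k => P (flow (M k) t (z k))) (f t)) :
    obs h z =ᵐ[volume.restrict (Set.Icc 0 T)] f := by
  -- The partial sums converge in `L²`, hence almost everywhere along a sequence.
  obtain ⟨s, hs, h_lim⟩ :=
    (tendstoInMeasure_of_tendsto_Lp (hasSum_obs h z)).exists_seq_tendsto_ae'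
  have h_partial : ∀ᵐ t ∂volume.restrict (Set.Icc 0 T), ∀ n,
      (∑ k ∈ s n, obsBlock P T (M k) (z k) : Lp G 2 _) t =
        ∑ k ∈ s n, P (flow (M k) t (z k)) := by
    refine ae_all_iff.2 fun n => ?_
    rw [sum_obsBlock]
    filter_upwards [coeFn_toL2 T (∑ k ∈ s n, obsFun P (M k) (z k))] with t ht
    simpa using ht
  filter_upwards [h_lim, h_partial] with t ht_lim ht_partial
  simp only [ht_partial] at ht_lim
  exact tendsto_nhds_unique ht_lim ((hf t).comp hs)

theorem norm_obs_blockGroup_le {T₀ τ : ℝ} (hM : FlowBounded M) (h₀ : Admissible P T₀ M)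
    (h : Admissible P T M) (hτ : 0 ≤ τ) (hT : τ + T₀ ≤ T) (z : ℓ²(ι, E)) :
    ‖obs h₀ (blockGroup hM τ z)‖ ≤ ‖obs h z‖ := by
  refine le_of_tendsto_of_tendsto (hasSum_obs h₀ _).norm (hasSum_obs h z).norm
    (Eventually.of_forall fun s => ?_)
  have h_shift : ∑ k ∈ s, obsFun P (M k) (blockGroup hM τ z k) =
      (∑ k ∈ s, obsFun P (M k) (z k)).comp (ContinuousMap.addRight τ) := by
    ext t
    simp [flow_add]
  simp only [sum_obsBlock, h_shift]
  exact norm_toL2_comp_addRight_le hτ hT _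

theorem eq_zero_of_obs_single_eq_zero [DecidableEq ι] (hT : 0 < T) (h : Admissible P T M) {k : ι}
    (h_observable : ∀ x, Set.EqOn (obsFun P (M k) x) 0 (Set.Icc 0 T) → x = 0) {x : E}
    (hx : obs h (lp.single 2 k x) = 0) : x = 0 :=
  h_observable x (eqOn_zero_of_toL2_eq_zero hT ((synthesis_single h k x).symm.trans hx))

end Observation

/-! ### From the observability of high blocks to full observability -/

section Compactness

variable {X F V : Type*} [NormedAddCommGroup X] [NormedSpace ℝ X] [CompleteSpace X]
  [NormedAddCommGroup F] [NormedSpace ℝ F] [NormedAddCommGroup V] [NormedSpace ℝ V]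
  {Ψ : X →L[ℝ] F} {r : X →L[ℝ] V} {C : ℝ}

theorem exists_tendsto_of_norm_le (hC : ∀ z, ‖z‖ ≤ C * (‖Ψ z‖ + ‖r z‖)) {τ : Type*} {l : Filter τ}
    [l.NeBot] {q : τ → X} {y : F} {v : V} (hΨ : Tendsto (fun t => Ψ (q t)) l (𝓝 y))
    (hr : Tendsto (fun t => r (q t)) l (𝓝 v)) : ∃ x, Tendsto q l (𝓝 x) := by
  have h_antilipschitz : AntilipschitzWith (2 * Real.nnabs C) (Ψ.prod r) := by
    refine (Ψ.prod r).antilipschitz_of_bound fun z => (hC z).trans ?_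
    calc C * (‖Ψ z‖ + ‖r z‖) ≤ |C| * (‖(Ψ z, r z)‖ + ‖(Ψ z, r z)‖) :=
          mul_le_mul (le_abs_self C) (add_le_add (norm_fst_le (Ψ z, r z)) (norm_snd_le (Ψ z, r z)))
            (by positivity) (abs_nonneg C)
      _ = (2 * Real.nnabs C : NNReal) * ‖(Ψ.prod r) z‖ := by
          rw [ContinuousLinearMap.prod_apply]; push_cast [Real.coe_nnabs]; ring
  have h_cauchy : Cauchy (map (fun t => (Ψ.prod r) (q t)) l) := (hΨ.prodMk_nhds hr).cauchy_map
  exact cauchy_map_iff_exists_tendsto.1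
    ((h_antilipschitz.isUniformInducing (Ψ.prod r).uniformContinuous).cauchy_map_iff.1 h_cauchy)

theorem exists_norm_le_of_injective (hr : IsCompactOperator r)
    (hC : ∀ z, ‖z‖ ≤ C * (‖Ψ z‖ + ‖r z‖)) (hΨ : Function.Injective Ψ) :
    ∃ c, 0 < c ∧ ∀ z, ‖z‖ ≤ c * ‖Ψ z‖ := by
  by_contra! h_unbounded
  have h_unit : ∀ n : ℕ, ∃ z : X, ‖z‖ = 1 ∧ ‖Ψ z‖ ≤ 1 / ((n : ℝ) + 1) := by
    intro n
    obtain ⟨z, hz⟩ := h_unbounded ((n : ℝ) + 1) (by positivity)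
    have hz₀ : 0 < ‖z‖ := lt_of_le_of_lt (by positivity) hz
    refine ⟨‖z‖⁻¹ • z, ?_, ?_⟩
    · rw [norm_smul, norm_inv, norm_norm, inv_mul_cancel₀ hz₀.ne']
    · rw [map_smul, norm_smul, norm_inv, norm_norm, inv_mul_le_iff₀ hz₀, mul_one_div,
        le_div_iff₀ (by positivity)]
      linarith
  choose z hz_norm hz_obs using h_unit
  have h_obs : Tendsto (fun n => Ψ (z n)) atTop (𝓝 0) :=
    squeeze_zero_norm hz_obs tendsto_one_div_add_atTop_nhds_zero_nat
  obtain ⟨v, -, φ, hφ, hv⟩ := (hr.isCompact_closure_image_closedBall 1).tendsto_subseq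
    fun n => subset_closure (Set.mem_image_of_mem r (mem_closedBall_zero_iff.2 (hz_norm n).le))
  obtain ⟨x, hx⟩ := exists_tendsto_of_norm_le hC (h_obs.comp hφ.tendsto_atTop) hv
  have hx_norm : ‖x‖ = 1 := tendsto_nhds_unique hx.norm (by simp [hz_norm])
  have hx_obs : Ψ x = 0 := tendsto_nhds_unique ((Ψ.continuous.tendsto x).comp hx)
    (h_obs.comp hφ.tendsto_atTop)
  have hx_zero : x = 0 := hΨ (hx_obs.trans (map_zero Ψ).symm)
  exact one_ne_zero (hx_norm.symm.trans (hx_zero ▸ norm_zero))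

end Compactness

section Unobserved

variable {X F V : Type*} [NormedAddCommGroup X] [NormedSpace ℝ X]
  [NormedAddCommGroup F] [NormedSpace ℝ F] [NormedAddCommGroup V] [NormedSpace ℝ V]
  {S : ℝ → X →L[ℝ] X} {Ψ : X →L[ℝ] F} {r : X →L[ℝ] V} {C : ℝ} {n : ℕ} {z : X}

/-- The states whose evolution under `S` is in the kernel of `Ψ` throughout `[0, n]`. -/
def unobserved (S : ℝ → X →L[ℝ] X) (Ψ : X →L[ℝ] F) (n : ℕ) : Submodule ℝ X :=
  ⨅ τ ∈ Set.Icc (0 : ℝ) n, (Ψ.comp (S τ)).ker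

theorem mem_unobserved : z ∈ unobserved S Ψ n ↔ ∀ τ ∈ Set.Icc (0 : ℝ) n, Ψ (S τ z) = 0 := by
  simp [unobserved]

theorem unobserved_antitone : Antitone (unobserved S Ψ) := fun _ _ h _ hz =>
  mem_unobserved.2 fun τ hτ => mem_unobserved.1 hz τ ⟨hτ.1, hτ.2.trans (Nat.cast_le.2 h)⟩

theorem apply_eq_zero_of_mem_unobserved (hS : IsStronglyContinuousGroup S)
    (hz : z ∈ unobserved S Ψ n) : Ψ z = 0 := by
  simpa [hS.map_zero] using mem_unobserved.1 hz 0 ⟨le_rfl, n.cast_nonneg⟩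

theorem slope_mem_unobserved (hS : IsStronglyContinuousGroup S) (hz : z ∈ unobserved S Ψ (n + 1))
    {t : ℝ} (ht : t ∈ Set.Ioc (0 : ℝ) 1) : t⁻¹ • (S t z - z) ∈ unobserved S Ψ n := by
  refine Submodule.smul_mem _ _ (Submodule.sub_mem _ (mem_unobserved.2 fun τ hτ => ?_)
    (unobserved_antitone n.le_succ hz))
  rw [← ContinuousLinearMap.comp_apply (S τ), ← hS.map_add]
  refine mem_unobserved.1 hz _ ⟨add_nonneg hτ.1 ht.1.le, ?_⟩
  push_cast
  exact add_le_add hτ.2 ht.2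

/-- Unobserved states lie in the domain of the generator as soon as their evolution is
differentiable modulo the kernel of `r`. -/
theorem exists_unobserved_tendsto_slope [CompleteSpace X] (hS : IsStronglyContinuousGroup S)
    (hC : ∀ z, ‖z‖ ≤ C * (‖Ψ z‖ + ‖r z‖)) (hz : z ∈ unobserved S Ψ (n + 1)) {v : V}
    (hv : Tendsto (fun t : ℝ => r (t⁻¹ • (S t z - z))) (𝓝[>] 0) (𝓝 v)) :
    ∃ z' ∈ unobserved S Ψ n, Tendsto (fun t : ℝ => t⁻¹ • (S t z - z)) (𝓝[>] 0) (𝓝 z') := by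
  have h_mem : ∀ᶠ t in 𝓝[>] (0 : ℝ), t⁻¹ • (S t z - z) ∈ unobserved S Ψ n := by
    filter_upwards [Ioc_mem_nhdsGT zero_lt_one] with t ht using slope_mem_unobserved hS hz ht
  have h_obs : Tendsto (fun t : ℝ => Ψ (t⁻¹ • (S t z - z))) (𝓝[>] 0) (𝓝 0) :=
    tendsto_const_nhds.congr' (h_mem.mono fun t ht => (apply_eq_zero_of_mem_unobserved hS ht).symm)
  obtain ⟨z', hz'⟩ := exists_tendsto_of_norm_le hC h_obs hv
  refine ⟨z', mem_unobserved.2 fun τ hτ => ?_, hz'⟩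
  refine tendsto_nhds_unique (((Ψ.comp (S τ)).continuous.tendsto z').comp hz') ?_
  exact tendsto_const_nhds.congr' (h_mem.mono fun t ht => (mem_unobserved.1 ht τ hτ).symm)

end Unobserved

section Uniqueness

open Polynomial

variable {ι E F : Type*} [NormedAddCommGroup E] [NormedSpace ℝ E]
  [NormedAddCommGroup F] [NormedSpace ℝ F]
  {M : ι → E →L[ℝ] E} {Ψ : ℓ²(ι, E) →L[ℝ] F} {L : Finset ι} {C : ℝ}

/-- The coordinates in a finite set of blocks. -/
def lowBlocks (L : Finset ι) : ℓ²(ι, E) →L[ℝ] (L → E) :=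
  ContinuousLinearMap.pi fun k => lp.evalCLM ℝ (fun _ : ι => E) 2 (k : ι)

@[simp] theorem lowBlocks_apply (z : ℓ²(ι, E)) (k : L) : lowBlocks L z k = z k := rfl

theorem norm_sum_single_le [DecidableEq ι] (L : Finset ι) (z : ℓ²(ι, E)) :
    ‖∑ k ∈ L, lp.single (E := fun _ : ι => E) 2 k (z k)‖ ≤ L.card * ‖lowBlocks L z‖ := by
  rw [← nsmul_eq_mul]
  refine (norm_sum_le _ _).trans (Finset.sum_le_card_nsmul _ _ _ fun k hk => ?_)
  rw [lp.norm_single two_pos]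
  exact norm_le_pi_norm (lowBlocks L z) ⟨k, hk⟩

theorem exists_norm_le_add_lowBlocks {c : ℝ}
    (h_tail : ∀ z : ℓ²(ι, E), (∀ k ∈ L, z k = 0) → ‖z‖ ≤ c * ‖Ψ z‖) :
    ∃ C, ∀ z, ‖z‖ ≤ C * (‖Ψ z‖ + ‖lowBlocks L z‖) := by
  classical
  refine ⟨|c| + (|c| * ‖Ψ‖ + 1) * L.card, fun z => ?_⟩
  set z_low : ℓ²(ι, E) := ∑ k ∈ L, lp.single 2 k (z k) with hz_low
  have h_low : ‖z_low‖ ≤ L.card * ‖lowBlocks L z‖ := norm_sum_single_le L z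
  have h_high : ‖z - z_low‖ ≤ |c| * ‖Ψ (z - z_low)‖ := by
    refine (h_tail _ fun k hk => ?_).trans
      (mul_le_mul_of_nonneg_right (le_abs_self c) (norm_nonneg _))
    rw [lp.coeFn_sub, Pi.sub_apply, hz_low, lp.coeFn_sum, Finset.sum_apply,
      Finset.sum_eq_single k (fun j _ hj => lp.single_apply_ne _ _ _ hj.symm)
        (fun h => absurd hk h), lp.single_apply_self, sub_self]
  have h_obs : ‖Ψ (z - z_low)‖ ≤ ‖Ψ z‖ + ‖Ψ‖ * ‖z_low‖ := by
    rw [map_sub]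
    exact (norm_sub_le _ _).trans (by gcongr; exact Ψ.le_opNorm _)
  have h_cross : 0 ≤ |c| * ‖lowBlocks L z‖ + (|c| * ‖Ψ‖ + 1) * L.card * ‖Ψ z‖ := by positivity
  calc ‖z‖ ≤ ‖z - z_low‖ + ‖z_low‖ := by simpa using norm_add_le (z - z_low) z_low
    _ ≤ |c| * (‖Ψ z‖ + ‖Ψ‖ * ‖z_low‖) + ‖z_low‖ := by gcongr; exact h_high.trans (by gcongr)
    _ = |c| * ‖Ψ z‖ + (|c| * ‖Ψ‖ + 1) * ‖z_low‖ := by ring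
    _ ≤ |c| * ‖Ψ z‖ + (|c| * ‖Ψ‖ + 1) * (L.card * ‖lowBlocks L z‖) := by gcongr
    _ ≤ (|c| + (|c| * ‖Ψ‖ + 1) * L.card) * (‖Ψ z‖ + ‖lowBlocks L z‖) := by linarith

theorem injective_aeval_prod {κ : Type*} {s : Finset κ} {Q : κ → ℝ[X]} {N : E →L[ℝ] E}
    (h : ∀ j ∈ s, Function.Injective (aeval N (Q j))) :
    Function.Injective (aeval N (∏ j ∈ s, Q j)) := by
  classical
  induction s using Finset.induction_on with
  | empty => simpa using Function.injective_id
  | insert j s hj ih =>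
    rw [Finset.prod_insert hj, map_mul]
    exact (h j (by simp)).comp (ih fun i hi => h i (by simp [hi]))

theorem aeval_prod_eq_zero {κ A : Type*} [Ring A] [Algebra ℝ A] {s : Finset κ} {Q : κ → ℝ[X]}
    {k : κ} (hk : k ∈ s) {N : A} (h : aeval N (Q k) = 0) : aeval N (∏ j ∈ s, Q j) = 0 := by
  obtain ⟨R, hR⟩ := Finset.dvd_prod_of_mem Q hk
  rw [hR, map_mul, h, zero_mul]

variable [CompleteSpace E] {hM : FlowBounded M}

theorem exists_unobserved_generator
    (hC : ∀ z, ‖z‖ ≤ C * (‖Ψ z‖ + ‖lowBlocks L z‖)) {n : ℕ} {z : ℓ²(ι, E)}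
    (hz : z ∈ unobserved (blockGroup hM) Ψ (n + 1)) :
    ∃ z' ∈ unobserved (blockGroup hM) Ψ n, ∀ k, z' k = M k (z k) := by
  have h_coord : ∀ k, Tendsto (fun t : ℝ => t⁻¹ • (flow (M k) t (z k) - z k)) (𝓝[>] 0)
      (𝓝 (M k (z k))) := fun k => by
    simpa using (hasDerivAt_flow_apply (M k) (z k) 0).tendsto_slope_zero_right
  obtain ⟨z', hz', h_lim⟩ := exists_unobserved_tendsto_slope
    (isStronglyContinuousGroup_blockGroup hM) hC hz (tendsto_pi_nhds.2 fun k : L => h_coord k)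
  exact ⟨z', hz', fun k => tendsto_nhds_unique
    (((lp.evalCLM ℝ (fun _ : ι => E) 2 k).continuous.tendsto z').comp h_lim) (h_coord k)⟩

theorem exists_unobserved_aeval (hC : ∀ z, ‖z‖ ≤ C * (‖Ψ z‖ + ‖lowBlocks L z‖)) (Q : ℝ[X]) :
    ∃ n : ℕ, ∀ (a : ℕ), ∀ z ∈ unobserved (blockGroup hM) Ψ (a + n),
      ∃ z' ∈ unobserved (blockGroup hM) Ψ a, ∀ k, z' k = aeval (M k) Q (z k) := by
  induction Q using Polynomial.induction_on with
  | C c => exact ⟨0, fun a z hz => ⟨c • z, Submodule.smul_mem _ _ hz, fun k => by simp⟩⟩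
  | add p q hp hq =>
    obtain ⟨n_p, h_p⟩ := hp
    obtain ⟨n_q, h_q⟩ := hq
    refine ⟨max n_p n_q, fun a z hz => ?_⟩
    obtain ⟨z_p, hz_p, h_eq_p⟩ := h_p a z (unobserved_antitone (by omega) hz)
    obtain ⟨z_q, hz_q, h_eq_q⟩ := h_q a z (unobserved_antitone (by omega) hz)
    exact ⟨z_p + z_q, Submodule.add_mem _ hz_p hz_q, fun k => by simp [h_eq_p, h_eq_q]⟩
  | monomial m c ih =>
    obtain ⟨n, hn⟩ := ih
    refine ⟨n + 1, fun a z hz => ?_⟩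
    obtain ⟨z_M, hz_M, h_M⟩ := exists_unobserved_generator hC (n := a + n) hz
    obtain ⟨z', hz', h_aeval⟩ := hn a z_M hz_M
    refine ⟨z', hz', fun k => ?_⟩
    rw [h_aeval, h_M, pow_succ, ← mul_assoc, map_mul _ _ X, aeval_X]
    rfl

variable {Q : ι → ℝ[X]}

theorem exists_unobserved_eq_zero_of_notMem
    (hC : ∀ z, ‖z‖ ≤ C * (‖Ψ z‖ + ‖lowBlocks L z‖)) (hQ : ∀ k, aeval (M k) (Q k) = 0)
    (hQ_inj : ∀ j k, j ≠ k → Function.Injective (aeval (M k) (Q j))) :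
    ∃ n, ∀ z ∈ unobserved (blockGroup hM) Ψ n, ∀ k ∉ L, z k = 0 := by
  -- The product of the `Q j` over `L` annihilates the blocks in `L`, and what is left is controlled
  -- by the observation alone.
  obtain ⟨n, hn⟩ := exists_unobserved_aeval (hM := hM) hC (∏ j ∈ L, Q j)
  refine ⟨0 + n, fun z hz k hk => ?_⟩
  obtain ⟨z', hz', h_aeval⟩ := hn 0 z hz
  have h_low : lowBlocks L z' = 0 := by
    ext j
    simp [h_aeval, aeval_prod_eq_zero j.2 (hQ j)]
  have h_obs : Ψ z' = 0 :=
    apply_eq_zero_of_mem_unobserved (isStronglyContinuousGroup_blockGroup hM) hz'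
  have h_zero : z' = 0 := by simpa [h_low, h_obs] using hC z'
  refine injective_aeval_prod (fun j hj => hQ_inj j k (ne_of_mem_of_not_mem hj hk)) ?_
  rw [← h_aeval, h_zero, map_zero]
  rfl

theorem exists_unobserved_apply_eq_zero [DecidableEq ι]
    (hC : ∀ z, ‖z‖ ≤ C * (‖Ψ z‖ + ‖lowBlocks L z‖)) (hQ : ∀ k, aeval (M k) (Q k) = 0)
    (hQ_inj : ∀ j k, j ≠ k → Function.Injective (aeval (M k) (Q j)))
    {k : ι} (h_single : ∀ x, Ψ (lp.single 2 k x) = 0 → x = 0) :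
    ∃ n, ∀ z ∈ unobserved (blockGroup hM) Ψ n, (∀ j ∉ L, z j = 0) → z k = 0 := by
  -- The product of the `Q j` over `j ∈ L`, `j ≠ k`, annihilates all blocks of `z` except `z k`.
  obtain ⟨n, hn⟩ := exists_unobserved_aeval (hM := hM) hC (∏ j ∈ L.erase k, Q j)
  refine ⟨0 + n, fun z hz h_tail => ?_⟩
  obtain ⟨z', hz', h_aeval⟩ := hn 0 z hz
  have h_eq : z' = lp.single 2 k (z' k) := by
    ext j
    obtain rfl | hj := eq_or_ne j k
    · rw [lp.single_apply_self]
    rw [lp.single_apply_ne _ _ _ hj, h_aeval]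
    by_cases hjL : j ∈ L
    · rw [aeval_prod_eq_zero (Finset.mem_erase.2 ⟨hj, hjL⟩) (hQ j)]; rfl
    · rw [h_tail j hjL, map_zero]
  have h_obs : Ψ z' = 0 :=
    apply_eq_zero_of_mem_unobserved (isStronglyContinuousGroup_blockGroup hM) hz'
  have h_zero : z' k = 0 := h_single _ (h_eq ▸ h_obs)
  refine injective_aeval_prod (s := L.erase k)
    (fun j hj => hQ_inj j k (Finset.ne_of_mem_erase hj)) ?_
  rw [← h_aeval, h_zero, map_zero]

theorem exists_unobserved_eq_bot [DecidableEq ι]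
    (hC : ∀ z, ‖z‖ ≤ C * (‖Ψ z‖ + ‖lowBlocks L z‖)) (hQ : ∀ k, aeval (M k) (Q k) = 0)
    (hQ_inj : ∀ j k, j ≠ k → Function.Injective (aeval (M k) (Q j)))
    (h_single : ∀ k x, Ψ (lp.single 2 k x) = 0 → x = 0) :
    ∃ n, unobserved (blockGroup hM) Ψ n = ⊥ := by
  obtain ⟨m, hm⟩ := exists_unobserved_eq_zero_of_notMem (hM := hM) hC hQ hQ_inj
  choose n hn using fun k =>
    exists_unobserved_apply_eq_zero (hM := hM) hC hQ hQ_inj (h_single k)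
  refine ⟨m + ∑ k ∈ L, n k, (Submodule.eq_bot_iff _).2 fun z hz => ?_⟩
  have h_tail : ∀ k ∉ L, z k = 0 := hm z (unobserved_antitone (by omega) hz)
  ext k
  by_cases hk : k ∈ L
  · have h_le : n k ≤ ∑ j ∈ L, n j := Finset.single_le_sum (fun _ _ => Nat.zero_le _) hk
    exact hn k z (unobserved_antitone (by omega) hz) h_tail
  · exact h_tail k hk

end Uniqueness

section Observability

open Polynomial

variable {ι E G : Type*} [NormedAddCommGroup E] [NormedSpace ℝ E] [FiniteDimensional ℝ E]

theorem isCompactOperator_lowBlocks (L : Finset ι) :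
    IsCompactOperator (lowBlocks L : ℓ²(ι, E) →L[ℝ] (L → E)) := by
  have : ProperSpace E := FiniteDimensional.proper ℝ E
  exact isCompactOperator_of_locallyCompactSpace_dom _

variable [CompleteSpace E] [NormedAddCommGroup G] [NormedSpace ℝ G] [CompleteSpace G]
  {P : E →L[ℝ] G} {M : ι → E →L[ℝ] E} {T₀ : ℝ}

theorem exists_norm_le_obs (hM : FlowBounded M) (h₀ : Admissible P T₀ M) (hT₀ : 0 < T₀)
    {L : Finset ι} {c : ℝ} (h_tail : ∀ z : ℓ²(ι, E), (∀ k ∈ L, z k = 0) → ‖z‖ ≤ c * ‖obs h₀ z‖)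
    {Q : ι → ℝ[X]} (hQ : ∀ k, aeval (M k) (Q k) = 0)
    (hQ_inj : ∀ j k, j ≠ k → Function.Injective (aeval (M k) (Q j)))
    (h_observable : ∀ k x, Set.EqOn (obsFun P (M k) x) 0 (Set.Icc 0 T₀) → x = 0) :
    ∃ n : ℕ, ∀ (T : ℝ) (h : Admissible P T M), T₀ + n ≤ T →
      ∃ c, 0 < c ∧ ∀ z, ‖z‖ ≤ c * ‖obs h z‖ := by
  classical
  obtain ⟨C, hC⟩ := exists_norm_le_add_lowBlocks h_tail
  obtain ⟨n, hn⟩ := exists_unobserved_eq_bot (hM := hM) hC hQ hQ_inj fun k _ =>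
    eq_zero_of_obs_single_eq_zero hT₀ h₀ (h_observable k)
  refine ⟨n, fun T h hT => ?_⟩
  have h_shift : ∀ τ ∈ Set.Icc (0 : ℝ) n, ∀ z, ‖obs h₀ (blockGroup hM τ z)‖ ≤ ‖obs h z‖ :=
    fun τ hτ z => norm_obs_blockGroup_le hM h₀ h hτ.1 (by linarith [hτ.2]) z
  refine exists_norm_le_of_injective (C := |C|) (isCompactOperator_lowBlocks L) (fun z => ?_)
    ((injective_iff_map_eq_zero _).2 fun z hz => ?_)
  · have h_zero := h_shift 0 ⟨le_rfl, n.cast_nonneg⟩ z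
    rw [(isStronglyContinuousGroup_blockGroup hM).map_zero] at h_zero
    exact (hC z).trans (mul_le_mul (le_abs_self C) (add_le_add_left h_zero _) (by positivity)
      (abs_nonneg C))
  · rw [← Submodule.mem_bot ℝ, ← hn, mem_unobserved]
    exact fun τ hτ => norm_le_zero_iff.1 ((h_shift τ hτ z).trans (by rw [hz, norm_zero]))

end Observability

/-! ### Orthogonality of the trigonometric system -/

theorem integral_cos_int_mul (m : ℕ) {j : ℤ} (hj : j ≠ 0) :
    ∫ t in (0 : ℝ)..2 * Real.pi * m, Real.cos (j * t) = 0 := by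
  have h_end : (j : ℝ) * (2 * Real.pi * m) = ((2 * j * m : ℤ) : ℝ) * Real.pi := by push_cast; ring
  rw [intervalIntegral.integral_comp_mul_left _ (Int.cast_ne_zero.2 hj), integral_cos, h_end,
    Real.sin_int_mul_pi, mul_zero, Real.sin_zero, sub_zero, smul_zero]

theorem integral_sin_int_mul (m : ℕ) (j : ℤ) :
    ∫ t in (0 : ℝ)..2 * Real.pi * m, Real.sin (j * t) = 0 := by
  obtain rfl | hj := eq_or_ne j 0
  · simp
  have h_end : (j : ℝ) * (2 * Real.pi * m) = ((j * m : ℤ) : ℝ) * (2 * Real.pi) := by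
    push_cast; ring
  rw [intervalIntegral.integral_comp_mul_left _ (Int.cast_ne_zero.2 hj), integral_sin, h_end,
    Real.cos_int_mul_two_pi, mul_zero, Real.cos_zero, sub_self, smul_zero]

theorem trig_mul_trig (p q : ℕ) (a b a' b' t : ℝ) :
    (a * Real.cos (p * t) + b * Real.sin (p * t)) *
        (a' * Real.cos (q * t) + b' * Real.sin (q * t)) =
      (a * a' + b * b') / 2 * Real.cos ((p - q : ℤ) * t) +
      (a * a' - b * b') / 2 * Real.cos ((p + q : ℤ) * t) +
      (a * b' + b * a') / 2 * Real.sin ((p + q : ℤ) * t) +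
      (b * a' - a * b') / 2 * Real.sin ((p - q : ℤ) * t) := by
  push_cast
  rw [sub_mul, add_mul (p : ℝ) q t, Real.cos_sub, Real.cos_add, Real.sin_add, Real.sin_sub]
  ring

theorem integral_trig_mul_trig (m : ℕ) {p : ℕ} (hp : 0 < p) (q : ℕ) (a b a' b' : ℝ) :
    ∫ t in (0 : ℝ)..2 * Real.pi * m, (a * Real.cos (p * t) + b * Real.sin (p * t)) *
      (a' * Real.cos (q * t) + b' * Real.sin (q * t)) =
      if p = q then Real.pi * m * (a * a' + b * b') else 0 := by
  simp_rw [trig_mul_trig]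
  rw [intervalIntegral.integral_add, intervalIntegral.integral_add, intervalIntegral.integral_add,
    intervalIntegral.integral_const_mul, intervalIntegral.integral_const_mul,
    intervalIntegral.integral_const_mul, intervalIntegral.integral_const_mul,
    integral_cos_int_mul m (j := (p + q : ℤ)) (by omega), integral_sin_int_mul,
    integral_sin_int_mul]
  · split_ifs with hpq
    · subst hpq
      simp only [sub_self, Int.cast_zero, zero_mul, Real.cos_zero, integral_one, mul_zero]
      ring
    · rw [integral_cos_int_mul m (j := (p - q : ℤ)) (by omega)]
      ring
  all_goals exact Continuous.intervalIntegrable (by fun_prop) _ _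

theorem integral_trig_sum_sq {ι : Type*} (m : ℕ) (s : Finset ι) {n : ι → ℕ}
    (hn : Function.Injective n) (h_pos : ∀ k, 0 < n k) (a b : ι → ℝ) :
    ∫ t in Set.Icc 0 (2 * Real.pi * m),
      (∑ k ∈ s, (a k * Real.cos (n k * t) + b k * Real.sin (n k * t))) ^ 2 =
      Real.pi * m * ∑ k ∈ s, (a k ^ 2 + b k ^ 2) := by
  classical
  rw [integral_Icc_eq_integral_Ioc, ← intervalIntegral.integral_of_le (by positivity)]
  simp_rw [sq, Finset.sum_mul_sum]
  rw [intervalIntegral.integral_finsetSum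
    fun k _ => Continuous.intervalIntegrable (by fun_prop) _ _, Finset.mul_sum]
  refine Finset.sum_congr rfl fun k hk => ?_
  rw [intervalIntegral.integral_finsetSum
    fun k _ => Continuous.intervalIntegrable (by fun_prop) _ _]
  simp_rw [integral_trig_mul_trig m (h_pos k), hn.eq_iff]
  rw [Finset.sum_ite_eq, if_pos hk]

/-! ### The rescaled blocks and their normal modes -/

local notation "ℝ²" => EuclideanSpace ℝ (Fin 2)

local notation "ℝ⁴" => EuclideanSpace ℝ (Fin 4)

theorem norm_sq_fin_two (z : ℝ²) : ‖z‖ ^ 2 = z 0 ^ 2 + z 1 ^ 2 := by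
  rw [EuclideanSpace.real_norm_sq_eq, Fin.sum_univ_two]

theorem norm_sq_fin_four (z : ℝ⁴) : ‖z‖ ^ 2 = z 0 ^ 2 + z 1 ^ 2 + z 2 ^ 2 + z 3 ^ 2 := by
  rw [EuclideanSpace.real_norm_sq_eq, Fin.sum_univ_four]

theorem norm_le_of_abs_apply_le_two {z : ℝ²} {r : ℝ} (h : ∀ i, |z i| ≤ r) : ‖z‖ ≤ 2 * r := by
  have hr : 0 ≤ r := (abs_nonneg _).trans (h 0)
  have h_sq : ∀ i, z i ^ 2 ≤ r ^ 2 := fun i => sq_le_sq' (abs_le.1 (h i)).1 (abs_le.1 (h i)).2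
  refine le_of_sq_le_sq ?_ (by positivity)
  rw [norm_sq_fin_two]
  linarith [h_sq 0, h_sq 1, sq_nonneg r]

theorem norm_le_of_abs_apply_le_four {z : ℝ⁴} {r : ℝ} (h : ∀ i, |z i| ≤ r) : ‖z‖ ≤ 2 * r := by
  have hr : 0 ≤ r := (abs_nonneg _).trans (h 0)
  have h_sq : ∀ i, z i ^ 2 ≤ r ^ 2 := fun i => sq_le_sq' (abs_le.1 (h i)).1 (abs_le.1 (h i)).2
  refine le_of_sq_le_sq ?_ (by positivity)
  rw [norm_sq_fin_four]
  linarith [h_sq 0, h_sq 1, h_sq 2, h_sq 3]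

theorem hasDerivAt_fin_four {z : ℝ → ℝ⁴} {z' : ℝ⁴} {t : ℝ} :
    HasDerivAt z z' t ↔ ∀ i, HasDerivAt (fun t => z t i) (z' i) t := by
  refine ⟨fun h i => (EuclideanSpace.proj (𝕜 := ℝ) i).hasFDerivAt.comp_hasDerivAt t h, fun h => ?_⟩
  exact (PiLp.continuousLinearEquiv 2 ℝ fun _ : Fin 4 => ℝ).symm.hasFDerivAt.comp_hasDerivAt t
    (hasDerivAt_pi.2 h)

/-- The generator of the block with parameter `k` in the coordinates `(x₁, x₂, y₁, y₂)` in which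
the norm of the state space is Euclidean: the positions are `x₁, x₂`, the velocities are `k y₁` and
`k² y₂`, and `g`, `h` are the rescaled couplings `C` and `B`. -/
def blockGen (A D k g h : ℝ) : ℝ⁴ →L[ℝ] ℝ⁴ :=
  LinearMap.toContinuousLinearMap
    { toFun := fun z => !₂[k * z 2, k ^ 2 * z 3, -((k ^ 2 + A) * z 0 + g * z 1) / k,
        -((k ^ 4 + D) * z 1 + h * z 0) / k ^ 2]
      map_add' := fun x y => by ext i; fin_cases i <;> simp <;> ring
      map_smul' := fun c x => by ext i; fin_cases i <;> simp <;> ring }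

theorem blockGen_apply (A D k g h : ℝ) (z : ℝ⁴) :
    blockGen A D k g h z = !₂[k * z 2, k ^ 2 * z 3, -((k ^ 2 + A) * z 0 + g * z 1) / k,
      -((k ^ 4 + D) * z 1 + h * z 0) / k ^ 2] := rfl

/-- The projection of a block onto the positions `(x₁, x₂)`. -/
def posProj : ℝ⁴ →L[ℝ] ℝ² :=
  LinearMap.toContinuousLinearMap
    { toFun := fun z => !₂[z 0, z 1]
      map_add' := fun x y => by ext i; fin_cases i <;> simp
      map_smul' := fun c x => by ext i; fin_cases i <;> simp }

theorem posProj_apply (z : ℝ⁴) : posProj z = !₂[z 0, z 1] := rfl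

/-- The rotations through the angles `ω₁ t` in the plane of the coordinates `0, 2` and `ω₂ t` in the
plane of the coordinates `1, 3`. -/
def rotation (ω₁ ω₂ t : ℝ) (w : ℝ⁴) : ℝ⁴ :=
  !₂[w 0 * Real.cos (ω₁ * t) + w 2 * Real.sin (ω₁ * t),
    w 1 * Real.cos (ω₂ * t) + w 3 * Real.sin (ω₂ * t),
    w 2 * Real.cos (ω₁ * t) - w 0 * Real.sin (ω₁ * t),
    w 3 * Real.cos (ω₂ * t) - w 1 * Real.sin (ω₂ * t)]

section Rotation

variable {ω₁ ω₂ μ₁ μ₂ ρ t : ℝ} {w : ℝ⁴}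

theorem rotation_zero (w : ℝ⁴) : rotation ω₁ ω₂ 0 w = w := by
  ext i; fin_cases i <;> simp [rotation]

theorem norm_rotation (ω₁ ω₂ t : ℝ) (w : ℝ⁴) : ‖rotation ω₁ ω₂ t w‖ = ‖w‖ := by
  rw [← sq_eq_sq₀ (norm_nonneg _) (norm_nonneg _), norm_sq_fin_four, norm_sq_fin_four]
  simp only [rotation, Matrix.cons_val]
  linear_combination (w 0 ^ 2 + w 2 ^ 2) * Real.sin_sq_add_cos_sq (ω₁ * t) +
    (w 1 ^ 2 + w 3 ^ 2) * Real.sin_sq_add_cos_sq (ω₂ * t)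

theorem hasDerivAt_rotation (ω₁ ω₂ : ℝ) (w : ℝ⁴) (t : ℝ) :
    HasDerivAt (fun t => rotation ω₁ ω₂ t w)
      !₂[ω₁ * rotation ω₁ ω₂ t w 2, ω₂ * rotation ω₁ ω₂ t w 3,
        -(ω₁ * rotation ω₁ ω₂ t w 0), -(ω₂ * rotation ω₁ ω₂ t w 1)] t := by
  have h_cos : ∀ ω, HasDerivAt (fun t => Real.cos (ω * t)) (-Real.sin (ω * t) * ω) t := fun ω => by
    simpa using ((hasDerivAt_id t).const_mul ω).cos
  have h_sin : ∀ ω, HasDerivAt (fun t => Real.sin (ω * t)) (Real.cos (ω * t) * ω) t := fun ω => by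
    simpa using ((hasDerivAt_id t).const_mul ω).sin
  refine hasDerivAt_fin_four.2 fun i => ?_
  fin_cases i
  · exact (((h_cos ω₁).const_mul _).add ((h_sin ω₁).const_mul _)).congr_deriv
      (by simp [rotation]; ring)
  · exact (((h_cos ω₂).const_mul _).add ((h_sin ω₂).const_mul _)).congr_deriv
      (by simp [rotation]; ring)
  · exact (((h_cos ω₁).const_mul _).sub ((h_sin ω₁).const_mul _)).congr_deriv
      (by simp [rotation]; ring)
  · exact (((h_cos ω₂).const_mul _).sub ((h_sin ω₂).const_mul _)).congr_deriv
      (by simp [rotation]; ring)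

theorem abs_trig_sub_trig_le {ω μ a b N : ℝ} (hω : |ω - μ| ≤ ρ) (ha : |a| ≤ N) (hb : |b| ≤ N) :
    |(a * Real.cos (ω * t) + b * Real.sin (ω * t)) -
      (a * Real.cos (μ * t) + b * Real.sin (μ * t))| ≤ 2 * (ρ * |t|) * N := by
  have hN : 0 ≤ N := (abs_nonneg a).trans ha
  have h_angle : |ω * t - μ * t| ≤ ρ * |t| := by
    rw [← sub_mul, abs_mul]; gcongr
  have h_cos := (Real.abs_cos_sub_cos_le (ω * t) (μ * t)).trans h_angle
  have h_sin := (Real.abs_sin_sub_sin_le (ω * t) (μ * t)).trans h_angle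
  calc _ = |a * (Real.cos (ω * t) - Real.cos (μ * t)) +
          b * (Real.sin (ω * t) - Real.sin (μ * t))| := by congr 1; ring
    _ ≤ |a| * |Real.cos (ω * t) - Real.cos (μ * t)| +
          |b| * |Real.sin (ω * t) - Real.sin (μ * t)| := by
        rw [← abs_mul, ← abs_mul]; exact abs_add_le _ _
    _ ≤ N * (ρ * |t|) + N * (ρ * |t|) := by gcongr
    _ = _ := by ring

theorem abs_apply_le_norm (z : ℝ⁴) (i : Fin 4) : |z i| ≤ ‖z‖ := PiLp.norm_apply_le z i

theorem norm_posProj_rotation_sub_le (h₁ : |ω₁ - μ₁| ≤ ρ) (h₂ : |ω₂ - μ₂| ≤ ρ) :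
    ‖posProj (rotation ω₁ ω₂ t w) - posProj (rotation μ₁ μ₂ t w)‖ ≤ 2 * (2 * (ρ * |t|) * ‖w‖) := by
  refine norm_le_of_abs_apply_le_two fun i => ?_
  have h_le := abs_apply_le_norm w
  fin_cases i
  · exact abs_trig_sub_trig_le h₁ (h_le 0) (h_le 2)
  · exact abs_trig_sub_trig_le h₂ (h_le 1) (h_le 3)

end Rotation

/-- The eigenvectors `(1, ε)`, `(δ, 1)` and the frequencies `ω₁`, `ω₂` of the stiffness matrix
`!![k ^ 2 + A, g; h, k ^ 4 + D]`, within `C / k` of those of the uncoupled block. -/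
structure NormalModes (A D k g h C : ℝ) where
  (δ ε ω₁ ω₂ : ℝ)
  eigen₁₁ : k ^ 2 + A + g * ε = ω₁ ^ 2
  eigen₁₂ : h + (k ^ 4 + D) * ε = ω₁ ^ 2 * ε
  eigen₂₁ : (k ^ 2 + A) * δ + g = ω₂ ^ 2 * δ
  eigen₂₂ : h * δ + (k ^ 4 + D) = ω₂ ^ 2
  one_le : 1 ≤ k
  two_mul_le : 2 * C ≤ k
  abs_δ_le : |δ| ≤ C / k
  abs_ε_le : |ε| ≤ C / k
  abs_ω₁_sub_le : |ω₁ - k| ≤ C / k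
  abs_ω₂_sub_le : |ω₂ - k ^ 2| ≤ C / k

theorem exists_mul_add_self_eq {d p : ℝ} (hp : 0 ≤ d ^ 2 + 4 * p) :
    ∃ θ, θ * (θ + d) = p ∧ d / 2 ≤ θ + d := by
  refine ⟨(√(d ^ 2 + 4 * p) - d) / 2, ?_, ?_⟩
  · linear_combination Real.sq_sqrt hp / 4
  · linarith [Real.sqrt_nonneg (d ^ 2 + 4 * p)]

theorem exists_sq_eq_abs_sub_le {μ l m : ℝ} (hμ : 0 < μ) (hl : |l - μ ^ 2| ≤ m) (hm : m ≤ μ ^ 2) :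
    ∃ ω, ω ^ 2 = l ∧ |ω - μ| ≤ m / μ := by
  have h_sq := Real.sq_sqrt (show 0 ≤ l by linarith [(abs_le.1 hl).1])
  refine ⟨√l, h_sq, (le_div_iff₀ hμ).2 ?_⟩
  calc |√l - μ| * μ ≤ |√l - μ| * |√l + μ| := by
        gcongr
        exact (le_add_of_nonneg_left (Real.sqrt_nonneg l)).trans (le_abs_self _)
    _ = |l - μ ^ 2| := by rw [← abs_mul]; congr 1; linear_combination h_sq
    _ ≤ m := hl

/-- The eigenvalue equation in terms of the shift `θ` of the eigenvalues: these are
`k² + A - θ` and `k⁴ + D + θ`, and `θ (θ + d) = g h` for the gap `d` of the diagonal. -/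
theorem exists_eigenvalue_shift (A D p : ℝ) : ∃ K, ∀ k, K ≤ k → ∃ θ,
    θ * (θ + (k ^ 4 + D - (k ^ 2 + A))) = p ∧ k ^ 4 / 4 ≤ θ + (k ^ 4 + D - (k ^ 2 + A)) ∧
      |θ| ≤ 1 := by
  refine ⟨4 * (|A| + |D| + |p| + 1), fun k hk => ?_⟩
  obtain ⟨hA, hD, hp⟩ := And.intro (abs_le.1 (le_refl |A|))
    (And.intro (abs_le.1 (le_refl |D|)) (abs_le.1 (le_refl |p|)))
  have hk₁ : 4 ≤ k := by linarith [abs_nonneg A, abs_nonneg D, abs_nonneg p]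
  have hk₂ : 4 * k ≤ k ^ 2 := by nlinarith only [hk₁]
  have hk₄ : 16 * k ^ 2 ≤ k ^ 4 := by nlinarith only [hk₁, hk₂]
  set d := k ^ 4 + D - (k ^ 2 + A)
  have h_gap : k ^ 4 / 2 ≤ d := by linarith [abs_nonneg p]
  have hd_large : 8 * (|p| + 1) ≤ d := by linarith [abs_nonneg A, abs_nonneg D]
  obtain ⟨θ, hθ, h_half⟩ := exists_mul_add_self_eq (d := d) (p := p)
    (by nlinarith only [hd_large, abs_nonneg p, hp])
  refine ⟨θ, hθ, by linarith only [h_half, h_gap], ?_⟩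
  have h_mul : |θ| * (θ + d) = |p| := by
    rw [← hθ, abs_mul, abs_of_nonneg (by linarith : 0 ≤ θ + d)]
  nlinarith only [abs_nonneg θ, h_mul, hd_large, h_half, abs_nonneg p]

theorem exists_normalModes (A D p : ℝ) {c : ℝ} (hc : 0 ≤ c) : ∃ C K, 0 ≤ C ∧ ∀ k, K ≤ k →
    ∀ g h, g * h = p → |g| ≤ c * k ^ 3 → |h| ≤ c * k ^ 3 → Nonempty (NormalModes A D k g h C) := by
  obtain ⟨K, hK⟩ := exists_eigenvalue_shift A D p
  set m := |A| + |D| + 1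
  have hA₀ := abs_nonneg A
  have hD₀ := abs_nonneg D
  refine ⟨4 * c + m, max K (8 * c + 2 * m), by positivity, fun k hk g h hgh hg hh => ?_⟩
  have hk_large : 8 * c + 2 * m ≤ k := (le_max_right _ _).trans hk
  have hk₁ : 1 ≤ k := by linarith
  have hk₀ : 0 < k := by linarith
  have h_sq : k ≤ k ^ 2 := by nlinarith
  obtain ⟨θ, hθ, h_gap, hθ₁⟩ := hK k ((le_max_left _ _).trans hk)
  set d := k ^ 4 + D - (k ^ 2 + A) with hd
  have h_pos : 0 < θ + d := lt_of_lt_of_le (by positivity) h_gap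
  have h_coupling : ∀ x, |x| ≤ c * k ^ 3 → |x / (θ + d)| ≤ (4 * c + m) / k := by
    intro x hx
    rw [abs_div, abs_of_pos h_pos, div_le_div_iff₀ h_pos hk₀]
    calc |x| * k ≤ c * k ^ 3 * k := by gcongr
      _ = 4 * c * (k ^ 4 / 4) := by ring
      _ ≤ (4 * c + m) * (θ + d) := by gcongr; linarith
  obtain ⟨ω₁, hω₁, h_near₁⟩ := exists_sq_eq_abs_sub_le (l := k ^ 2 + A - θ) (m := m) hk₀
    (by rw [show k ^ 2 + A - θ - k ^ 2 = A - θ by ring]; linarith [abs_sub A θ]) (by linarith)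
  obtain ⟨ω₂, hω₂, h_near₂⟩ := exists_sq_eq_abs_sub_le (μ := k ^ 2) (l := k ^ 4 + D + θ) (m := m)
    (by positivity)
    (by rw [show k ^ 4 + D + θ - (k ^ 2) ^ 2 = D + θ by ring]; linarith [abs_add_le D θ])
    (by nlinarith)
  exact ⟨{
    δ := g / (θ + d)
    ε := -(h / (θ + d))
    ω₁ := ω₁
    ω₂ := ω₂
    eigen₁₁ := by rw [hω₁]; field_simp; linear_combination hθ - hgh
    eigen₁₂ := by rw [hω₁]; field_simp; linear_combination -h * hd
    eigen₂₁ := by rw [hω₂]; field_simp; linear_combination g * hd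
    eigen₂₂ := by rw [hω₂]; field_simp; linear_combination hgh - hθ
    one_le := hk₁
    two_mul_le := by linarith
    abs_δ_le := h_coupling g hg
    abs_ε_le := (abs_neg _).trans_le (h_coupling h hh)
    abs_ω₁_sub_le := h_near₁.trans (by gcongr; linarith)
    abs_ω₂_sub_le := h_near₂.trans (by gcongr; linarith) }⟩

theorem abs_add_mul_le {x y u v Z p q : ℝ} (hx : |x| ≤ Z) (hy : |y| ≤ Z) (hu : |u| ≤ p)
    (hv : |v| ≤ q) : |u * x + v * y| ≤ (p + q) * Z := by
  have hp : 0 ≤ p := (abs_nonneg u).trans hu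
  have hq : 0 ≤ q := (abs_nonneg v).trans hv
  calc _ ≤ |u| * |x| + |v| * |y| := by rw [← abs_mul, ← abs_mul]; exact abs_add_le _ _
    _ ≤ p * Z + q * Z := by gcongr
    _ = _ := by ring

theorem abs_mul_le_mul {x y p q : ℝ} (hx : |x| ≤ p) (hy : |y| ≤ q) : |x * y| ≤ p * q := by
  rw [abs_mul]; exact mul_le_mul hx hy (abs_nonneg _) ((abs_nonneg _).trans hx)

theorem norm_le_mul_of_forall_exists {x z : ℝ⁴} {r : ℝ} (h : ∀ i, ∃ q ≤ r, |x i| ≤ q * ‖z‖) :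
    ‖x‖ ≤ 2 * r * ‖z‖ := by
  rw [mul_assoc]
  refine norm_le_of_abs_apply_le_four fun i => ?_
  obtain ⟨q, hqr, hq⟩ := h i
  exact hq.trans (by gcongr)

namespace NormalModes

variable {A D k g h C : ℝ} (N : NormalModes A D k g h C)

/-- The state of the block whose modal coordinates are `w`. -/
def toState (w : ℝ⁴) : ℝ⁴ :=
  !₂[w 0 + N.δ * w 1, N.ε * w 0 + w 1, N.ω₁ / k * w 2 + N.δ * k * (N.ω₂ / k ^ 2) * w 3,
    N.ε / k * (N.ω₁ / k) * w 2 + N.ω₂ / k ^ 2 * w 3]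

include N in
theorem pos : 0 < k := zero_lt_one.trans_le N.one_le

include N in
theorem div_le_half : C / k ≤ 1 / 2 := by
  rw [div_le_div_iff₀ N.pos two_pos]; linarith [N.two_mul_le]

include N in
theorem nonneg : 0 ≤ C := by
  have h_div := (abs_nonneg _).trans N.abs_δ_le
  rwa [le_div_iff₀ N.pos, zero_mul] at h_div

theorem half_le_ω₁ : k / 2 ≤ N.ω₁ := by
  linarith [(abs_le.1 N.abs_ω₁_sub_le).1, N.div_le_half, N.one_le]

theorem ω₁_le : N.ω₁ ≤ 2 * k := by
  linarith [(abs_le.1 N.abs_ω₁_sub_le).2, N.div_le_half, N.one_le]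

theorem half_le_ω₂ : k ^ 2 / 2 ≤ N.ω₂ := by
  linarith [(abs_le.1 N.abs_ω₂_sub_le).1, N.div_le_half, one_le_pow₀ N.one_le (n := 2)]

theorem ω₂_le : N.ω₂ ≤ 2 * k ^ 2 := by
  linarith [(abs_le.1 N.abs_ω₂_sub_le).2, N.div_le_half, one_le_pow₀ N.one_le (n := 2)]

theorem ω₁_pos : 0 < N.ω₁ := (half_pos N.pos).trans_le N.half_le_ω₁

theorem ω₂_pos : 0 < N.ω₂ := (half_pos (pow_pos N.pos 2)).trans_le N.half_le_ω₂

theorem abs_δ_le_half : |N.δ| ≤ 1 / 2 := N.abs_δ_le.trans N.div_le_half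

theorem abs_ε_le_half : |N.ε| ≤ 1 / 2 := N.abs_ε_le.trans N.div_le_half

theorem abs_δ_mul_le : |N.δ * k| ≤ C := by
  rw [abs_mul, abs_of_pos N.pos]; exact (le_div_iff₀ N.pos).1 N.abs_δ_le

theorem abs_ε_div_le : |N.ε / k| ≤ 1 / 2 := by
  rw [abs_div, abs_of_pos N.pos]
  exact (div_le_self (abs_nonneg _) N.one_le).trans (N.abs_ε_le.trans N.div_le_half)

theorem abs_ω₁_div_le : |N.ω₁ / k| ≤ 2 := by
  rw [abs_of_pos (div_pos N.ω₁_pos N.pos), div_le_iff₀ N.pos]; exact N.ω₁_le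

theorem abs_ω₂_div_le : |N.ω₂ / k ^ 2| ≤ 2 := by
  have hk := pow_pos N.pos 2
  rw [abs_of_pos (div_pos N.ω₂_pos hk), div_le_iff₀ hk]; exact N.ω₂_le

theorem three_quarters_le : 3 / 4 ≤ 1 - N.δ * N.ε := by
  have h_mul := abs_mul_le_mul N.abs_δ_le_half N.abs_ε_le_half
  linarith [(abs_le.1 h_mul).2]

theorem flow_toState (t : ℝ) (w : ℝ⁴) :
    flow (blockGen A D k g h) t (N.toState w) = N.toState (rotation N.ω₁ N.ω₂ t w) := by
  have hk := N.pos.ne'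
  have h_deriv : ∀ t, HasDerivAt (fun t => N.toState (rotation N.ω₁ N.ω₂ t w))
      (blockGen A D k g h (N.toState (rotation N.ω₁ N.ω₂ t w))) t := by
    intro t
    have h_rot := hasDerivAt_fin_four.1 (hasDerivAt_rotation N.ω₁ N.ω₂ w t)
    refine hasDerivAt_fin_four.2 fun i => ?_
    fin_cases i
    · refine ((h_rot 0).add ((h_rot 1).const_mul N.δ)).congr_deriv ?_
      simp [toState, blockGen_apply]; field_simp
    · refine (((h_rot 0).const_mul N.ε).add (h_rot 1)).congr_deriv ?_
      simp [toState, blockGen_apply]; field_simp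
    · refine (((h_rot 2).const_mul (N.ω₁ / k)).add
        ((h_rot 3).const_mul (N.δ * k * (N.ω₂ / k ^ 2)))).congr_deriv ?_
      simp [toState, blockGen_apply]; field_simp
      linear_combination rotation N.ω₁ N.ω₂ t w 0 * N.eigen₁₁ +
        rotation N.ω₁ N.ω₂ t w 1 * N.eigen₂₁
    · refine (((h_rot 2).const_mul (N.ε / k * (N.ω₁ / k))).add
        ((h_rot 3).const_mul (N.ω₂ / k ^ 2))).congr_deriv ?_
      simp [toState, blockGen_apply]; field_simp
      linear_combination rotation N.ω₁ N.ω₂ t w 0 * N.eigen₁₂ +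
        rotation N.ω₁ N.ω₂ t w 1 * N.eigen₂₂
  have h_flow := eq_flow_of_hasDerivAt h_deriv t
  rwa [rotation_zero, eq_comm] at h_flow

theorem norm_toState_le (w : ℝ⁴) : ‖N.toState w‖ ≤ 2 * (4 * (1 + C)) * ‖w‖ := by
  have hC := N.nonneg
  have h_le := abs_apply_le_norm w
  refine norm_le_mul_of_forall_exists fun i => ?_
  fin_cases i
  · refine ⟨_, ?_, one_mul (w 0) ▸
      abs_add_mul_le (h_le 0) (h_le 1) abs_one.le N.abs_δ_le_half⟩
    linarith
  · refine ⟨_, ?_, one_mul (w 1) ▸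
      abs_add_mul_le (h_le 0) (h_le 1) N.abs_ε_le_half abs_one.le⟩
    linarith
  · refine ⟨_, ?_, abs_add_mul_le (h_le 2) (h_le 3) N.abs_ω₁_div_le
      (abs_mul_le_mul N.abs_δ_mul_le N.abs_ω₂_div_le)⟩
    linarith
  · refine ⟨_, ?_, abs_add_mul_le (h_le 2) (h_le 3)
      (abs_mul_le_mul N.abs_ε_div_le N.abs_ω₁_div_le) N.abs_ω₂_div_le⟩
    linarith

/-- The modal coordinates of the state `z`, the inverse of `toState`. -/
def ofState (z : ℝ⁴) : ℝ⁴ :=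
  let J := 1 - N.δ * N.ε
  !₂[1 / J * z 0 + 1 / J * -N.δ * z 1, 1 / J * -N.ε * z 0 + 1 / J * z 1,
    k / (J * N.ω₁) * z 2 + k / (J * N.ω₁) * -(N.δ * k) * z 3,
    k ^ 2 / (J * N.ω₂) * -(N.ε / k) * z 2 + k ^ 2 / (J * N.ω₂) * z 3]

theorem toState_ofState (z : ℝ⁴) : N.toState (N.ofState z) = z := by
  have hk := N.pos
  have hω₁ := N.ω₁_pos
  have hω₂ := N.ω₂_pos
  have hJ : 1 - N.δ * N.ε ≠ 0 := by linarith [N.three_quarters_le]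
  have hJ' : 1 - N.ε * N.δ ≠ 0 := by rwa [mul_comm]
  ext i
  fin_cases i <;> simp [toState, ofState] <;> field_simp <;> ring

theorem norm_ofState_le (z : ℝ⁴) : ‖N.ofState z‖ ≤ 2 * (4 * (1 + C)) * ‖z‖ := by
  have hC := N.nonneg
  have hk := N.pos
  have hω₁ := N.ω₁_pos
  have hω₂ := N.ω₂_pos
  have hJ := N.three_quarters_le
  have hJ_pos : 0 < 1 - N.δ * N.ε := by linarith
  have h_le := abs_apply_le_norm z
  have h_inv : |1 / (1 - N.δ * N.ε)| ≤ 4 / 3 := by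
    rw [abs_of_pos (by positivity), div_le_iff₀ hJ_pos]; linarith
  have h_inv₁ : |k / ((1 - N.δ * N.ε) * N.ω₁)| ≤ 8 / 3 := by
    rw [abs_of_pos (by positivity), div_le_iff₀ (by positivity)]
    linarith [mul_le_mul hJ N.half_le_ω₁ (by positivity) hJ_pos.le]
  have h_inv₂ : |k ^ 2 / ((1 - N.δ * N.ε) * N.ω₂)| ≤ 8 / 3 := by
    rw [abs_of_pos (by positivity), div_le_iff₀ (by positivity)]
    linarith [mul_le_mul hJ N.half_le_ω₂ (by positivity) hJ_pos.le]
  refine norm_le_mul_of_forall_exists fun i => ?_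
  fin_cases i
  · refine ⟨_, ?_, abs_add_mul_le (h_le 0) (h_le 1) h_inv
      (abs_mul_le_mul h_inv ((abs_neg _).trans_le N.abs_δ_le_half))⟩
    linarith
  · refine ⟨_, ?_, abs_add_mul_le (h_le 0) (h_le 1)
      (abs_mul_le_mul h_inv ((abs_neg _).trans_le N.abs_ε_le_half)) h_inv⟩
    linarith
  · refine ⟨_, ?_, abs_add_mul_le (h_le 2) (h_le 3) h_inv₁
      (abs_mul_le_mul h_inv₁ ((abs_neg _).trans_le N.abs_δ_mul_le))⟩
    linarith
  · refine ⟨_, ?_, abs_add_mul_le (h_le 2) (h_le 3)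
      (abs_mul_le_mul h_inv₂ ((abs_neg _).trans_le N.abs_ε_div_le)) h_inv₂⟩
    linarith

theorem norm_posProj_toState_sub_le (w : ℝ⁴) :
    ‖posProj (N.toState w) - posProj w‖ ≤ 2 * (C / k * ‖w‖) := by
  refine norm_le_of_abs_apply_le_two fun i => ?_
  fin_cases i
  · simpa [posProj_apply, toState] using abs_mul_le_mul N.abs_δ_le (abs_apply_le_norm w 1)
  · simpa [posProj_apply, toState] using abs_mul_le_mul N.abs_ε_le (abs_apply_le_norm w 0)

end NormalModes

/-! ### Observation of the high blocks -/

theorem eq_zero_of_hasDerivAt_of_eqOn {x : ℝ → ℝ} {x' T : ℝ} (hT : 0 < T) (hx : HasDerivAt x x' 0)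
    (h_eqOn : Set.EqOn x 0 (Set.Icc 0 T)) : x' = 0 := by
  have h_mem : (0 : ℝ) ∈ Set.Icc 0 T := Set.left_mem_Icc.2 hT.le
  exact (uniqueDiffOn_Icc hT 0 h_mem).eq_deriv _ hx.hasDerivWithinAt
    ((hasDerivWithinAt_const 0 _ 0).congr h_eqOn (h_eqOn h_mem))

theorem eq_zero_of_eqOn_obsFun_blockGen {A D k g h T : ℝ} (hk : k ≠ 0) (hT : 0 < T) (z : ℝ⁴)
    (hz : Set.EqOn (obsFun posProj (blockGen A D k g h) z) 0 (Set.Icc 0 T)) : z = 0 := by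
  have h_flow := hasDerivAt_fin_four.1 (hasDerivAt_flow_apply (blockGen A D k g h) z 0)
  have h_pos : ∀ i, Set.EqOn (fun t => posProj (flow (blockGen A D k g h) t z) i) 0 (Set.Icc 0 T) :=
    fun i t ht => congrArg (fun x : ℝ² => x i) (hz ht)
  have h_mem : (0 : ℝ) ∈ Set.Icc 0 T := Set.left_mem_Icc.2 hT.le
  have hz₀ : z 0 = 0 := by simpa [posProj_apply, flow_zero] using h_pos 0 h_mem
  have hz₁ : z 1 = 0 := by simpa [posProj_apply, flow_zero] using h_pos 1 h_mem
  have hz₂ : k * z 2 = 0 := by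
    simpa [blockGen_apply, flow_zero] using eq_zero_of_hasDerivAt_of_eqOn hT (h_flow 0) (h_pos 0)
  have hz₃ : k ^ 2 * z 3 = 0 := by
    simpa [blockGen_apply, flow_zero] using eq_zero_of_hasDerivAt_of_eqOn hT (h_flow 1) (h_pos 1)
  ext i
  fin_cases i
  exacts [hz₀, hz₁, (mul_eq_zero.1 hz₂).resolve_left hk,
    (mul_eq_zero.1 hz₃).resolve_left (pow_ne_zero 2 hk)]

/-- The observation of the uncoupled block with frequencies `k` and `k ^ 2`. -/
def rotFun (k : ℕ+) (w : ℝ⁴) : C(ℝ, ℝ²) where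
  toFun t := posProj (rotation k (k ^ 2) t w)
  continuous_toFun := posProj.continuous.comp <| continuous_iff_continuousAt.2 fun t =>
    (hasDerivAt_rotation k (k ^ 2) w t).continuousAt

theorem norm_toL2_sum_rotFun (m : ℕ) (s : Finset ℕ+) (w : ℕ+ → ℝ⁴) :
    ‖toL2 (2 * Real.pi * m) (∑ k ∈ s, rotFun k (w k))‖ =
      √(Real.pi * m) * √(∑ k ∈ s, ‖w k‖ ^ 2) := by
  have h_apply : ∀ t, ‖(∑ k ∈ s, rotFun k (w k)) t‖ ^ 2 =
      (∑ k ∈ s, (w k 0 * Real.cos ((k : ℕ) * t) + w k 2 * Real.sin ((k : ℕ) * t))) ^ 2 +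
      (∑ k ∈ s, (w k 1 * Real.cos (((k : ℕ) ^ 2 : ℕ) * t) +
        w k 3 * Real.sin (((k : ℕ) ^ 2 : ℕ) * t))) ^ 2 := by
    intro t
    rw [norm_sq_fin_two]
    simp [rotFun, posProj_apply, rotation]
  have h_sq_inj : Function.Injective fun k : ℕ+ => (k : ℕ) ^ 2 := fun i j hij =>
    PNat.coe_injective (Nat.pow_left_injective two_ne_zero hij)
  rw [← Real.sqrt_mul (by positivity), eq_comm, Real.sqrt_eq_iff_eq_sq (by positivity) (by simp),
    norm_toL2_sq]
  simp_rw [h_apply]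
  rw [integral_add, integral_trig_sum_sq m s PNat.coe_injective fun k => k.pos,
    integral_trig_sum_sq m s h_sq_inj fun k => pow_pos k.pos 2, ← mul_add,
    ← Finset.sum_add_distrib]
  · congr 1
    refine Finset.sum_congr rfl fun k _ => ?_
    rw [norm_sq_fin_four]; ring
  all_goals exact (by fun_prop : Continuous _).continuousOn.integrableOn_Icc

theorem sqrt_sum_sq_le_of_forall {ι E F : Type*} [NormedAddCommGroup E] [NormedAddCommGroup F]
    {s : Finset ι} {x : ι → E} {y : ι → F} {B : ℝ} (hB : 0 ≤ B) (h : ∀ k ∈ s, ‖x k‖ ≤ B * ‖y k‖) :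
    √(∑ k ∈ s, ‖x k‖ ^ 2) ≤ B * √(∑ k ∈ s, ‖y k‖ ^ 2) := by
  rw [← Real.sqrt_sq hB, ← Real.sqrt_mul (sq_nonneg B), Finset.mul_sum]
  refine Real.sqrt_le_sqrt (Finset.sum_le_sum fun k hk => ?_)
  rw [← mul_pow]
  exact pow_le_pow_left₀ (norm_nonneg _) (h k hk) 2

theorem norm_toL2_sum_le {ι G : Type*} [NormedAddCommGroup G] [NormedSpace ℝ G] {s : Finset ι}
    {f : ι → C(ℝ, G)} {a b : ι → ℝ} {T B : ℝ} (hT : 0 ≤ T) (hB : 0 ≤ B)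
    (h : ∀ k ∈ s, ∀ t ∈ Set.Icc 0 T, ‖f k t‖ ≤ B * (a k * b k)) :
    ‖toL2 T (∑ k ∈ s, f k)‖ ≤ √T * (B * (√(∑ k ∈ s, a k ^ 2) * √(∑ k ∈ s, b k ^ 2))) := by
  refine norm_toL2_le_of_forall hT (by positivity) fun t ht => ?_
  rw [ContinuousMap.sum_apply]
  calc _ ≤ ∑ k ∈ s, B * (a k * b k) := norm_sum_le_of_le s fun k hk => h k hk t ht
    _ = B * ∑ k ∈ s, a k * b k := by rw [Finset.mul_sum]
    _ ≤ _ := by gcongr; exact Real.sum_mul_le_sqrt_mul_sqrt s _ _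

namespace NormalModes

variable {A D g h C : ℝ} {k : ℕ+} (N : NormalModes A D k g h C)

theorem norm_flow_le (t : ℝ) (z : ℝ⁴) :
    ‖flow (blockGen A D k g h) t z‖ ≤ 8 * (1 + C) * ‖N.ofState z‖ := by
  rw [← N.toState_ofState z, N.flow_toState]
  refine (N.norm_toState_le _).trans_eq ?_
  rw [norm_rotation, N.toState_ofState]; ring

theorem norm_obsFun_sub_rotFun_le (t : ℝ) (z : ℝ⁴) :
    ‖obsFun posProj (blockGen A D k g h) z t - rotFun k (N.ofState z) t‖ ≤
      8 * (1 + C) * (1 + |t|) * (1 / (k : ℝ) * ‖N.ofState z‖) := by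
  have hC := N.nonneg
  set w := N.ofState z with hw
  have h_modes := N.norm_posProj_toState_sub_le (rotation N.ω₁ N.ω₂ t w)
  have h_rot := norm_posProj_rotation_sub_le (t := t) (w := w) N.abs_ω₁_sub_le N.abs_ω₂_sub_le
  rw [norm_rotation] at h_modes
  rw [obsFun_apply, ← N.toState_ofState z, N.flow_toState, ← hw]
  calc _ ≤ 2 * (C / k * ‖w‖) + 2 * (2 * (C / k * |t|) * ‖w‖) :=
        (norm_sub_le_norm_sub_add_norm_sub _ _ _).trans (add_le_add h_modes h_rot)
    _ = (2 * C + 4 * C * |t|) * (1 / (k : ℝ) * ‖w‖) := by ring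
    _ ≤ _ := by gcongr; nlinarith [abs_nonneg t, mul_nonneg hC (abs_nonneg t)]

end NormalModes

section HighBlocks

variable {A D p c : ℝ} {g h : ℕ+ → ℝ}

/-- Families of couplings `g`, `h` of the blocks with constant product `p` and at most cubic growth;
nothing else about the points `ξ`, `η` enters the analysis of the blocks. -/
structure IsCoupling (p c : ℝ) (g h : ℕ+ → ℝ) : Prop where
  nonneg : 0 ≤ c
  mul_eq : ∀ k, g k * h k = p
  abs_left_le : ∀ k : ℕ+, |g k| ≤ c * (k : ℝ) ^ 3
  abs_right_le : ∀ k : ℕ+, |h k| ≤ c * (k : ℝ) ^ 3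

theorem finite_pnat_lt (K : ℝ) : {k : ℕ+ | (k : ℝ) < K}.Finite := by
  refine (Set.finite_Iic ⌈K⌉₊.succPNat).subset fun k hk => ?_
  have h_lt : (k : ℕ) < ⌈K⌉₊ := Nat.lt_ceil.2 hk
  rw [Set.mem_Iic, ← PNat.coe_le_coe, Nat.succPNat_coe]
  omega

theorem exists_normalModes_of_notMem (A D : ℝ) (hgh : IsCoupling p c g h) :
    ∃ (L : Finset ℕ+) (C : ℝ), 0 ≤ C ∧
      ∀ k : ℕ+, k ∉ L → Nonempty (NormalModes A D k (g k) (h k) C) := by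
  obtain ⟨C, K, hC, h_modes⟩ := exists_normalModes A D p hgh.nonneg
  refine ⟨(finite_pnat_lt K).toFinset, C, hC, fun k hk => ?_⟩
  exact h_modes k (by simpa using hk) _ _ (hgh.mul_eq k) (hgh.abs_left_le k) (hgh.abs_right_le k)

theorem flowBounded_blockGen (A D : ℝ) (hgh : IsCoupling p c g h) :
    FlowBounded fun k : ℕ+ => blockGen A D k (g k) (h k) := by
  obtain ⟨L, C, hC, h_modes⟩ := exists_normalModes_of_notMem A D hgh
  refine flowBounded_of_forall_notMem L.finite_toSet fun T =>
    ⟨8 * (1 + C) * (2 * (4 * (1 + C))), fun k hk t _ => ?_⟩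
  obtain ⟨N⟩ := h_modes k hk
  refine ContinuousLinearMap.opNorm_le_bound _ (by positivity) fun z => ?_
  rw [mul_assoc _ _ ‖z‖]
  exact (N.norm_flow_le t z).trans (by gcongr; exact N.norm_ofState_le z)

/-- Here `N` is the norm of the amplitudes of the free rotations; the error is small relative to the
main term once `s` avoids sufficiently many low blocks. -/
theorem exists_norm_sum_obsBlock_sub_le (A D : ℝ) (hgh : IsCoupling p c g h) (m : ℕ) :
    ∃ (L : Finset ℕ+) (B κ : ℝ), 0 ≤ B ∧ 0 ≤ κ ∧ ∀ s : Finset ℕ+, Disjoint s L → ∀ z : ℕ+ → ℝ⁴,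
      ∃ N, 0 ≤ N ∧ N ≤ B * √(∑ k ∈ s, ‖z k‖ ^ 2) ∧ √(∑ k ∈ s, ‖z k‖ ^ 2) ≤ B * N ∧
        |‖∑ k ∈ s, obsBlock posProj (2 * Real.pi * m) (blockGen A D k (g k) (h k)) (z k)‖ -
          √(Real.pi * m) * N| ≤ κ * √(∑ k ∈ s, (1 / (k : ℝ)) ^ 2) * N := by
  obtain ⟨L, C, hC, h_modes⟩ := exists_normalModes_of_notMem A D hgh
  set T := 2 * Real.pi * m
  have hT : 0 ≤ T := by positivity
  refine ⟨L, 8 * (1 + C), √T * (8 * (1 + C) * (1 + T)), by positivity, by positivity,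
    fun s hs z => ?_⟩
  have h_modes' : ∀ k, ∃ w : ℝ⁴, k ∈ s → ‖w‖ ≤ 8 * (1 + C) * ‖z k‖ ∧ ‖z k‖ ≤ 8 * (1 + C) * ‖w‖ ∧
      ∀ t ∈ Set.Icc 0 T, ‖(obsFun posProj (blockGen A D k (g k) (h k)) (z k) - rotFun k w) t‖ ≤
        8 * (1 + C) * (1 + T) * (1 / (k : ℝ) * ‖w‖) := by
    intro k
    by_cases hk : k ∈ s
    · obtain ⟨N⟩ := h_modes k (Finset.disjoint_left.1 hs hk)
      refine ⟨N.ofState (z k), fun _ => ⟨(N.norm_ofState_le _).trans_eq (by ring), ?_, ?_⟩⟩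
      · simpa [flow_zero] using N.norm_flow_le 0 (z k)
      · refine fun t ht => (N.norm_obsFun_sub_rotFun_le t (z k)).trans ?_
        gcongr
        exact (abs_of_nonneg ht.1).trans_le ht.2
    · exact ⟨0, fun hk' => absurd hk' hk⟩
  choose w hw using h_modes'
  refine ⟨√(∑ k ∈ s, ‖w k‖ ^ 2), by positivity,
    sqrt_sum_sq_le_of_forall (by positivity) fun k hk => (hw k hk).1,
    sqrt_sum_sq_le_of_forall (by positivity) fun k hk => (hw k hk).2.1, ?_⟩
  rw [sum_obsBlock, ← norm_toL2_sum_rotFun]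
  refine (abs_norm_sub_norm_le _ _).trans ?_
  rw [← map_sub, ← Finset.sum_sub_distrib]
  refine (norm_toL2_sum_le hT (by positivity) fun k hk => (hw k hk).2.2).trans_eq ?_
  ring

theorem summable_one_div_pnat_sq : Summable fun k : ℕ+ => (1 / (k : ℝ)) ^ 2 := by
  have h_summable : Summable fun n : ℕ => (1 / (n : ℝ)) ^ 2 := by
    simp [Real.summable_nat_pow_inv]
  exact h_summable.comp_injective PNat.coe_injective

theorem admissible_blockGen (A D : ℝ) (hgh : IsCoupling p c g h) (m : ℕ) :
    Admissible posProj (2 * Real.pi * m) fun k : ℕ+ => blockGen A D k (g k) (h k) := by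
  obtain ⟨L, B, κ, hB, hκ, h_near⟩ := exists_norm_sum_obsBlock_sub_le A D hgh m
  set S := √(∑' k : ℕ+, (1 / (k : ℝ)) ^ 2)
  refine isBessel_of_disjoint L (C := (√(Real.pi * m) + κ * S) * B) (by positivity)
    fun s hs z => ?_
  obtain ⟨N, hN₀, hN, -, h_err⟩ := h_near s hs z
  have h_tail : √(∑ k ∈ s, (1 / (k : ℝ)) ^ 2) ≤ S :=
    Real.sqrt_le_sqrt (summable_one_div_pnat_sq.sum_le_tsum s fun _ _ => by positivity)
  calc _ ≤ √(Real.pi * m) * N + κ * √(∑ k ∈ s, (1 / (k : ℝ)) ^ 2) * N :=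
        sub_le_iff_le_add'.1 (abs_le.1 h_err).2
    _ ≤ √(Real.pi * m) * N + κ * S * N := by gcongr
    _ = (√(Real.pi * m) + κ * S) * N := by ring
    _ ≤ (√(Real.pi * m) + κ * S) * (B * √(∑ k ∈ s, ‖z k‖ ^ 2)) := by gcongr
    _ = _ := by ring

theorem exists_norm_le_sum_obsBlock (A D : ℝ) (hgh : IsCoupling p c g h) {m : ℕ} (hm : 0 < m) :
    ∃ (L : Finset ℕ+) (c' : ℝ), ∀ s : Finset ℕ+, Disjoint s L → ∀ z : ℕ+ → ℝ⁴,
      √(∑ k ∈ s, ‖z k‖ ^ 2) ≤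
        c' * ‖∑ k ∈ s, obsBlock posProj (2 * Real.pi * m) (blockGen A D k (g k) (h k)) (z k)‖ := by
  obtain ⟨L, B, κ, hB, hκ, h_near⟩ := exists_norm_sum_obsBlock_sub_le A D hgh m
  set q := √(Real.pi * m)
  have hq : 0 < q := Real.sqrt_pos.2 (by positivity)
  set η := q / (2 * (κ + 1)) with hη
  have hη₀ : 0 < η := by positivity
  obtain ⟨L', h_vanish⟩ :=
    summable_iff_vanishing_norm.1 summable_one_div_pnat_sq (η ^ 2) (by positivity)
  classical
  refine ⟨L ∪ L', 2 * B / q, fun s hs z => ?_⟩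
  rw [Finset.disjoint_union_right] at hs
  obtain ⟨N, hN₀, -, hN, h_err⟩ := h_near s hs.1 z
  have h_tail : √(∑ k ∈ s, (1 / (k : ℝ)) ^ 2) ≤ η :=
    Real.sqrt_le_iff.2 ⟨hη₀.le, (le_abs_self _).trans (h_vanish s hs.2).le⟩
  have h_small : κ * √(∑ k ∈ s, (1 / (k : ℝ)) ^ 2) * N ≤ q / 2 * N := by
    calc _ ≤ (κ + 1) * η * N := by gcongr; linarith
      _ = _ := by rw [hη]; field_simp
  refine hN.trans ?_
  calc B * N = 2 * B / q * (q / 2 * N) := by field_simp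
    _ ≤ _ := by gcongr; linarith [(abs_le.1 h_err).1]

theorem exists_norm_le_obs_of_forall_mem_eq_zero (A D : ℝ) (hgh : IsCoupling p c g h) {m : ℕ}
    (hm : 0 < m) : ∃ (L : Finset ℕ+) (c' : ℝ), ∀ z, (∀ k ∈ L, z k = 0) →
      ‖z‖ ≤ c' * ‖obs (admissible_blockGen A D hgh m) z‖ := by
  classical
  obtain ⟨L, c', h_sum⟩ := exists_norm_le_sum_obsBlock A D hgh hm
  refine ⟨L, c', fun z hz => ?_⟩
  have h_norm : Tendsto (fun s : Finset ℕ+ => √(∑ k ∈ s, ‖z k‖ ^ 2)) atTop (𝓝 ‖z‖) := by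
    have h_sq := (ell2_summable_norm_sq z).hasSum.sqrt
    rwa [← ell2_norm_sq, Real.sqrt_sq (norm_nonneg z)] at h_sq
  refine le_of_tendsto_of_tendsto h_norm
    ((hasSum_obs (admissible_blockGen A D hgh m) z).norm.const_mul _) (.of_forall fun s => ?_)
  have h_low : ∀ k ∈ s, k ∉ s \ L → z k = 0 := fun k hk hk' => hz k (by simpa [hk] using hk')
  have h_high := h_sum (s \ L) Finset.sdiff_disjoint z
  rwa [Finset.sum_subset Finset.sdiff_subset fun k hk hk' => by simp [h_low k hk hk'],
    Finset.sum_subset Finset.sdiff_subset fun k hk hk' => by rw [h_low k hk hk', map_zero]]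
    at h_high

end HighBlocks

/-! ### Generic parameters -/

section Generic

open Polynomial

variable {A D p c : ℝ} {g h : ℕ+ → ℝ}

/-- The difference of the traces of the stiffness matrices of the blocks `k` and `j`. -/
def traceDiff (j k : ℝ) : ℝ := k ^ 2 + k ^ 4 - (j ^ 2 + j ^ 4)

/-- The difference of the determinants of the stiffness matrices of the blocks `j` and `k`. -/
def detDiff (A D j k : ℝ) : ℝ := (j ^ 2 + A) * (j ^ 4 + D) - (k ^ 2 + A) * (k ^ 4 + D)

/-- The parameters for which the blocks are invertible and have pairwise disjoint spectra. The
second condition is the nonvanishing of the resultant of two characteristic polynomials. -/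
structure Generic (A D p : ℝ) : Prop where
  det_ne : ∀ k : ℕ+, ((k : ℝ) ^ 2 + A) * ((k : ℝ) ^ 4 + D) ≠ p
  resultant_ne : ∀ j k : ℕ+, j ≠ k →
    (detDiff A D j k + traceDiff j k * ((k : ℝ) ^ 2 + A)) *
      (detDiff A D j k + traceDiff j k * ((k : ℝ) ^ 4 + D)) ≠ traceDiff j k ^ 2 * p

theorem blockGen_blockGen {k g h : ℝ} (hk : k ≠ 0) (z : ℝ⁴) :
    blockGen A D k g h (blockGen A D k g h z) =
      !₂[-((k ^ 2 + A) * z 0 + g * z 1), -((k ^ 4 + D) * z 1 + h * z 0),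
        -((k ^ 2 + A) * z 2 + g * k * z 3), -((k ^ 4 + D) * z 3 + h / k * z 2)] := by
  ext i
  fin_cases i <;> simp [blockGen_apply] <;> field_simp

/-- The characteristic polynomial of the block with parameter `k`. -/
def blockPoly (A D p k : ℝ) : ℝ[X] :=
  X ^ 4 + C (k ^ 2 + A + (k ^ 4 + D)) * X ^ 2 + C ((k ^ 2 + A) * (k ^ 4 + D) - p)

theorem blockPoly_eq_add (A D p j k : ℝ) :
    blockPoly A D p j = blockPoly A D p k + (C (detDiff A D j k) - C (traceDiff j k) * X ^ 2) := by
  simp only [blockPoly, detDiff, traceDiff, map_add, map_sub, map_mul]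
  ring

theorem aeval_biquadratic_apply {E : Type*} [NormedAddCommGroup E] [NormedSpace ℝ E]
    (M : E →L[ℝ] E) (a b : ℝ) (z : E) :
    aeval M (X ^ 4 + C a * X ^ 2 + C b : ℝ[X]) z = M (M (M (M z))) + a • M (M z) + b • z := by
  simp [Algebra.algebraMap_eq_smul_one, pow_succ]

theorem aeval_blockPoly_self {k g h : ℝ} (hk : k ≠ 0) (hgh : g * h = p) :
    aeval (blockGen A D k g h) (blockPoly A D p k) = 0 := by
  ext1 z
  rw [blockPoly, aeval_biquadratic_apply, blockGen_blockGen hk z, blockGen_blockGen hk, ← hgh]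
  ext i
  fin_cases i <;> simp <;> field_simp <;> ring

theorem aeval_blockPoly_apply (j : ℝ) {k g h : ℝ} (hk : k ≠ 0) (hgh : g * h = p) (z : ℝ⁴) :
    aeval (blockGen A D k g h) (blockPoly A D p j) z =
      detDiff A D j k • z - traceDiff j k • blockGen A D k g h (blockGen A D k g h z) := by
  rw [blockPoly_eq_add A D p j k, map_add, aeval_blockPoly_self hk hgh, zero_add]
  simp [Algebra.algebraMap_eq_smul_one, pow_two]

theorem eq_zero_of_det_ne_zero {α β γ δ x y : ℝ} (h_det : α * δ - β * γ ≠ 0)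
    (h₁ : α * x + β * y = 0) (h₂ : γ * x + δ * y = 0) : x = 0 ∧ y = 0 := by
  constructor
  · refine (mul_eq_zero.1 (?_ : (α * δ - β * γ) * x = 0)).resolve_left h_det
    linear_combination δ * h₁ - β * h₂
  · refine (mul_eq_zero.1 (?_ : (α * δ - β * γ) * y = 0)).resolve_left h_det
    linear_combination α * h₂ - γ * h₁

theorem pnat_pos (k : ℕ+) : 0 < (k : ℝ) := Nat.cast_pos.2 k.pos

theorem Generic.injective_aeval_blockPoly (h_gen : Generic A D p) (hgh : IsCoupling p c g h)
    {j k : ℕ+} (hjk : j ≠ k) :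
    Function.Injective (aeval (blockGen A D k (g k) (h k)) (blockPoly A D p j)) := by
  have hk := (pnat_pos k).ne'
  refine (injective_iff_map_eq_zero _).2 fun z hz => ?_
  rw [aeval_blockPoly_apply j hk (hgh.mul_eq k), blockGen_blockGen hk] at hz
  set e := detDiff A D j k
  set τ := traceDiff j k
  have h₀ : e * z 0 - τ * -((k ^ 2 + A) * z 0 + g k * z 1) = 0 := congrArg (fun x : ℝ⁴ => x 0) hz
  have h₁ : e * z 1 - τ * -((k ^ 4 + D) * z 1 + h k * z 0) = 0 := congrArg (fun x : ℝ⁴ => x 1) hz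
  have h₂ : e * z 2 - τ * -((k ^ 2 + A) * z 2 + g k * k * z 3) = 0 :=
    congrArg (fun x : ℝ⁴ => x 2) hz
  have h₃ : e * z 3 - τ * -((k ^ 4 + D) * z 3 + h k / k * z 2) = 0 :=
    congrArg (fun x : ℝ⁴ => x 3) hz
  have h_det := sub_ne_zero.2 (h_gen.resultant_ne j k hjk)
  obtain ⟨hz₀, hz₁⟩ := eq_zero_of_det_ne_zero (x := z 0) (y := z 1)
    (α := e + τ * ((k : ℝ) ^ 2 + A)) (β := τ * g k) (γ := τ * h k) (δ := e + τ * ((k : ℝ) ^ 4 + D))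
    (by convert h_det using 1; linear_combination -τ ^ 2 * hgh.mul_eq k)
    (by linear_combination h₀) (by linear_combination h₁)
  obtain ⟨hz₂, hz₃⟩ := eq_zero_of_det_ne_zero (x := z 2) (y := z 3)
    (α := e + τ * ((k : ℝ) ^ 2 + A)) (β := τ * (g k * k)) (γ := τ * (h k / k))
    (δ := e + τ * ((k : ℝ) ^ 4 + D))
    (by convert h_det using 1; field_simp; linear_combination -τ ^ 2 * hgh.mul_eq k)
    (by linear_combination h₂) (by linear_combination h₃)
  ext i
  fin_cases i
  exacts [hz₀, hz₁, hz₂, hz₃]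

theorem Generic.exists_norm_le_obs_blockGen (h_gen : Generic A D p) (hgh : IsCoupling p c g h) :
    ∃ m : ℕ, 0 < m ∧ ∃ c', 0 < c' ∧ ∀ z, ‖z‖ ≤ c' * ‖obs (admissible_blockGen A D hgh m) z‖ := by
  obtain ⟨L, c', h_tail⟩ := exists_norm_le_obs_of_forall_mem_eq_zero A D hgh one_pos
  have hT₀ : 0 < 2 * Real.pi * ((1 : ℕ) : ℝ) := by positivity
  obtain ⟨n, hn⟩ := exists_norm_le_obs (flowBounded_blockGen A D hgh)
    (admissible_blockGen A D hgh 1) hT₀ h_tail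
    (fun k => aeval_blockPoly_self (pnat_pos k).ne' (hgh.mul_eq k))
    (fun _ _ hjk => h_gen.injective_aeval_blockPoly hgh hjk)
    (fun k => eq_zero_of_eqOn_obsFun_blockGen (pnat_pos k).ne' hT₀)
  refine ⟨n + 1, n.succ_pos, hn _ _ ?_⟩
  push_cast
  nlinarith [Real.pi_gt_three, n.cast_nonneg (α := ℝ)]

end Generic

theorem ae_ne_of_ae_ae_ne {α β : Type*} [MeasureSpace α] [MeasureSpace β]
    [SFinite (volume : Measure β)] {φ ψ : α × β → ℝ} (hφ : Measurable φ) (hψ : Measurable ψ)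
    (h : ∀ᵐ a, ∀ᵐ b, φ (a, b) ≠ ψ (a, b)) : ∀ᵐ x, φ x ≠ ψ x :=
  (Measure.ae_prod_iff_ae_ae (measurableSet_eq_fun hφ hψ).compl).2 h

theorem ae_mul_ne {φ : ℝ × ℝ → ℝ} (hφ : Measurable φ) {q : ℝ} (hq : q ≠ 0) :
    ∀ᵐ x : ℝ × ℝ × ℝ × ℝ, φ (x.1, x.2.2.2) ≠ q * (x.2.1 * x.2.2.1) := by
  have h_ne : ∀ x₀ : ℝ, ∀ᵐ x : ℝ, x ≠ x₀ := fun x₀ => by simp [ae_iff, measure_singleton]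
  refine ae_ne_of_ae_ae_ne (by fun_prop) (by fun_prop) (.of_forall fun a => ?_)
  refine ae_ne_of_ae_ae_ne (by fun_prop) (by fun_prop) ?_
  filter_upwards [h_ne 0] with b hb
  have h_swap : ∀ᵐ x : ℝ × ℝ, φ (a, x.1) ≠ q * (b * x.2) := by
    refine ae_ne_of_ae_ae_ne (by fun_prop) (by fun_prop) (.of_forall fun d => ?_)
    filter_upwards [h_ne (φ (a, d) / (q * b))] with e he h_eq
    exact he (by rw [h_eq]; field_simp)
  exact Measure.measurePreserving_swap.quasiMeasurePreserving.ae h_swap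

theorem traceDiff_ne_zero {j k : ℕ+} (hjk : j ≠ k) : traceDiff j k ≠ 0 := by
  have h_strictMono : StrictMono fun n : ℕ => n ^ 2 + n ^ 4 :=
    (Nat.pow_left_strictMono two_ne_zero).add (Nat.pow_left_strictMono four_ne_zero)
  refine sub_ne_zero.2 fun h_eq => hjk (PNat.coe_injective (h_strictMono.injective ?_)).symm
  exact_mod_cast h_eq

theorem ae_generic : ∀ᵐ x : ℝ × ℝ × ℝ × ℝ, Generic x.1 x.2.2.2 (x.2.1 * x.2.2.1) := by
  have h_det : ∀ᵐ x : ℝ × ℝ × ℝ × ℝ, ∀ k : ℕ+,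
      ((k : ℝ) ^ 2 + x.1) * ((k : ℝ) ^ 4 + x.2.2.2) ≠ x.2.1 * x.2.2.1 :=
    ae_all_iff.2 fun k => by
      simpa only [one_mul] using ae_mul_ne (q := 1)
        (φ := fun y => ((k : ℝ) ^ 2 + y.1) * ((k : ℝ) ^ 4 + y.2)) (by fun_prop) one_ne_zero
  have h_resultant : ∀ᵐ x : ℝ × ℝ × ℝ × ℝ, ∀ j k : ℕ+, j ≠ k →
      (detDiff x.1 x.2.2.2 j k + traceDiff j k * ((k : ℝ) ^ 2 + x.1)) *
        (detDiff x.1 x.2.2.2 j k + traceDiff j k * ((k : ℝ) ^ 4 + x.2.2.2)) ≠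
          traceDiff j k ^ 2 * (x.2.1 * x.2.2.1) := by
    simp only [ae_all_iff]
    intro j k hjk
    exact ae_mul_ne (φ := fun y => (detDiff y.1 y.2 j k + traceDiff j k * ((k : ℝ) ^ 2 + y.1)) *
        (detDiff y.1 y.2 j k + traceDiff j k * ((k : ℝ) ^ 4 + y.2)))
      (by unfold detDiff; fun_prop) (pow_ne_zero 2 (traceDiff_ne_zero hjk))
  filter_upwards [h_det, h_resultant] with x hx_det hx_resultant
  exact ⟨hx_det, hx_resultant⟩

/-! ### Rescaling the state space -/

theorem weight_eq_sq (α : ℝ) (β : IrrPoint) (k : ℕ+) :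
    weight α β k = ((k : ℝ) ^ α * Real.sin (k * β.val)) ^ 2 := by
  rw [weight, mul_comm 2 α, Real.rpow_mul (pnat_pos k).le, Real.rpow_two, mul_pow]

theorem mem_coeffs_iff_summable_sq {α : ℝ} {β : IrrPoint} {a : ℕ+ → ℝ} :
    a ∈ coeffs α β ↔ Summable fun k : ℕ+ => ((k : ℝ) ^ α * Real.sin (k * β.val) * a k) ^ 2 := by
  simp_rw [mem_coeffs, weight_eq_sq, sq_abs, ← mul_pow]

theorem mem_coeffs_of_abs_le {α : ℝ} {β : IrrPoint} {a b : ℕ+ → ℝ}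
    (hb : Summable fun k => b k ^ 2)
    (hab : ∀ k : ℕ+, |(k : ℝ) ^ α * Real.sin (k * β.val) * a k| ≤ b k) : a ∈ coeffs α β :=
  mem_coeffs_iff_summable_sq.2 <| hb.of_nonneg_of_le (fun _ => sq_nonneg _) fun k =>
    sq_le_sq' (abs_le.1 (hab k)).1 (abs_le.1 (hab k)).2

theorem mem_coeffs_of_eq_apply {α : ℝ} {β : IrrPoint} {a : ℕ+ → ℝ} (z : ℓ²(ℕ+, ℝ⁴)) (i : Fin 4)
    (haz : ∀ k : ℕ+, (k : ℝ) ^ α * Real.sin (k * β.val) * a k = z k i) : a ∈ coeffs α β :=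
  mem_coeffs_of_abs_le (ell2_summable_norm_sq z) fun k => haz k ▸ abs_apply_le_norm (z k) i

section Rescale

variable {ξ η : IrrPoint}

/-- The rescaled coordinates of the `k`-th mode of a state, in which the norm of `𝓗'_{ξ,η}` is the
`ℓ²` norm. -/
def rescaleFun (U : StateSpace ξ η) (k : ℕ+) : ℝ⁴ :=
  !₂[Real.sin (k * ξ.val) * u₁ U k, Real.sin (k * η.val) * u₂ U k,
    Real.sin (k * ξ.val) / k * v₁ U k, Real.sin (k * η.val) / (k : ℝ) ^ 2 * v₂ U k]

theorem hasSum_norm_rescaleFun_sq (U : StateSpace ξ η) :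
    HasSum (fun k => ‖rescaleFun U k‖ ^ 2) (‖U‖ ^ 2) := by
  have h_sum : ∀ {α β} (u : DSpace α β),
      HasSum (fun k : ℕ+ => ((k : ℝ) ^ α * Real.sin (k * β.val) * u.coeff k) ^ 2) (‖u‖ ^ 2) := by
    intro α β u
    simp_rw [u.norm_sq_eq, mul_pow _ (u.coeff _), ← weight_eq_sq, ← sq_abs (u.coeff _)]
    exact (mem_coeffs.1 u.coeff_mem).hasSum
  have h_u₁ : HasSum (fun k => (_ * u₁ U k) ^ 2) _ := h_sum U.fst.fst
  have h_u₂ : HasSum (fun k => (_ * u₂ U k) ^ 2) _ := h_sum U.fst.snd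
  have h_v₁ : HasSum (fun k => (_ * v₁ U k) ^ 2) _ := h_sum U.snd.fst
  have h_v₂ : HasSum (fun k => (_ * v₂ U k) ^ 2) _ := h_sum U.snd.snd
  rw [WithLp.prod_norm_sq_eq_of_L2, WithLp.prod_norm_sq_eq_of_L2, WithLp.prod_norm_sq_eq_of_L2]
  convert (h_u₁.add h_u₂).add (h_v₁.add h_v₂) using 2 with k
  rw [norm_sq_fin_four, Real.rpow_zero, Real.rpow_neg_one, Real.rpow_neg (pnat_pos k).le,
    Real.rpow_two]
  simp only [rescaleFun, Matrix.cons_val]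
  ring

/-- The state with given rescaled coordinates. -/
def unscale (z : ℓ²(ℕ+, ℝ⁴)) : StateSpace ξ η :=
  mkState (fun k => z k 0 / Real.sin (k * ξ.val)) (fun k => z k 1 / Real.sin (k * η.val))
    (fun k => k * z k 2 / Real.sin (k * ξ.val))
    (fun k => (k : ℝ) ^ 2 * z k 3 / Real.sin (k * η.val))
    (mem_coeffs_of_eq_apply z 0 fun k => by
      have h_sin := sin_ne_zero ξ k
      rw [Real.rpow_zero]; field_simp)
    (mem_coeffs_of_eq_apply z 1 fun k => by
      have h_sin := sin_ne_zero η k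
      rw [Real.rpow_zero]; field_simp)
    (mem_coeffs_of_eq_apply z 2 fun k => by
      have h_sin := sin_ne_zero ξ k
      rw [Real.rpow_neg_one]; field_simp)
    (mem_coeffs_of_eq_apply z 3 fun k => by
      have h_sin := sin_ne_zero η k
      rw [Real.rpow_neg (pnat_pos k).le, Real.rpow_two]; field_simp)

theorem rescaleFun_unscale (z : ℓ²(ℕ+, ℝ⁴)) (k : ℕ+) :
    rescaleFun (unscale z : StateSpace ξ η) k = z k := by
  have hξ := sin_ne_zero ξ k
  have hη := sin_ne_zero η k
  ext i
  fin_cases i <;> simp [unscale, rescaleFun] <;> field_simp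

theorem rescaleFun_injective :
    Function.Injective (rescaleFun : StateSpace ξ η → ℕ+ → ℝ⁴) := by
  intro U V hUV
  have h_apply : ∀ k i, rescaleFun U k i = rescaleFun V k i := fun k i => by rw [hUV]
  refine state_ext (funext fun k => ?_) (funext fun k => ?_) (funext fun k => ?_)
    (funext fun k => ?_)
  · exact mul_left_cancel₀ (sin_ne_zero ξ k) (h_apply k 0)
  · exact mul_left_cancel₀ (sin_ne_zero η k) (h_apply k 1)
  · exact mul_left_cancel₀ (div_ne_zero (sin_ne_zero ξ k) (pnat_pos k).ne') (h_apply k 2)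
  · exact mul_left_cancel₀ (div_ne_zero (sin_ne_zero η k) (pow_pos (pnat_pos k) 2).ne')
      (h_apply k 3)

/-- The isometry of the state space onto `ℓ²` given by the rescaled coordinates. -/
def rescale (ξ η : IrrPoint) : StateSpace ξ η ≃ₗᵢ[ℝ] ℓ²(ℕ+, ℝ⁴) where
  toFun U := ⟨rescaleFun U, memℓp_two_of_summable (hasSum_norm_rescaleFun_sq U).summable⟩
  invFun := unscale
  map_add' U V := by
    ext k i
    change rescaleFun (U + V) k i = rescaleFun U k i + rescaleFun V k i
    fin_cases i <;> simp [rescaleFun] <;> ring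
  map_smul' c U := by
    ext k i
    change rescaleFun (c • U) k i = c * rescaleFun U k i
    fin_cases i <;> simp [rescaleFun] <;> ring
  left_inv U := rescaleFun_injective (funext fun k => rescaleFun_unscale _ k)
  right_inv z := by
    ext k : 2
    exact rescaleFun_unscale z k
  norm_map' U := by
    rw [← sq_eq_sq₀ (norm_nonneg _) (norm_nonneg _), ell2_norm_sq]
    exact (hasSum_norm_rescaleFun_sq U).tsum_eq

theorem rescale_apply (U : StateSpace ξ η) (k : ℕ+) : rescale ξ η U k = rescaleFun U k := rfl

end Rescale

/-! ### The couplings -/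

theorem exists_forall_abs_le_of_forall_summable {ι : Type*} {m : ι → ℝ}
    (hm : ∀ a : ι → ℝ, (Summable fun k => a k ^ 2) → Summable fun k => (m k * a k) ^ 2) :
    ∃ c, ∀ k, |m k| ≤ c := by
  classical
  let T : ℓ²(ι, ℝ) →ₗ[ℝ] ℓ²(ι, ℝ) :=
    { toFun z := ⟨fun k => m k * z k, memℓp_two_of_summable <| by
        simpa only [Real.norm_eq_abs, sq_abs] using
          hm z (by simpa using ell2_summable_norm_sq z)⟩
      map_add' x y := by ext k; exact mul_add _ _ _
      map_smul' c x := by ext k; exact mul_left_comm _ _ _ }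
  have h_eval : ∀ k, Continuous fun z : ℓ²(ι, ℝ) => z k := fun k =>
    (lp.evalCLM ℝ (fun _ : ι => ℝ) 2 k).continuous
  have h_cont : Continuous T := by
    refine T.continuous_of_seq_closed_graph fun u x y hux huy => ?_
    ext k
    exact tendsto_nhds_unique (((h_eval k).tendsto y).comp huy)
      ((((h_eval k).tendsto x).comp hux).const_mul (m k))
  refine ⟨‖(⟨T, h_cont⟩ : ℓ²(ι, ℝ) →L[ℝ] ℓ²(ι, ℝ))‖, fun k => ?_⟩
  have h_single := ContinuousLinearMap.le_opNorm ⟨T, h_cont⟩ (lp.single 2 k 1)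
  have h_apply : ‖T (lp.single 2 k 1) k‖ ≤ ‖T (lp.single 2 k 1)‖ :=
    lp.norm_apply_le_norm two_ne_zero _ k
  have h_eq : T (lp.single 2 k 1) k = m k := by
    change m k * (lp.single 2 k 1 : ℓ²(ι, ℝ)) k = m k
    rw [lp.single_apply_self, mul_one]
  rw [lp.norm_single two_pos, norm_one, mul_one] at h_single
  rw [h_eq] at h_apply
  exact h_apply.trans h_single

section Coupling

variable {A B C D : ℝ} {ξ η : IrrPoint}

/-- The coefficient with which the rescaled position `x₂` enters the equation of `x₁`, namely
`C sin (k ξ) / sin (k η)`; with `B` for `C` and `ξ`, `η` exchanged, that of `x₁` in the equation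
of `x₂`. -/
def coupling (C : ℝ) (ξ η : IrrPoint) (k : ℕ+) : ℝ :=
  C * Real.sin (k * ξ.val) / Real.sin (k * η.val)

theorem exists_abs_coupling_le {α : ℝ} (h : ∀ a ∈ coeffs (α + 3) η, C • a ∈ coeffs α ξ) :
    ∃ c, ∀ k : ℕ+, |coupling C ξ η k| ≤ c * (k : ℝ) ^ 3 := by
  have h_ne : ∀ k : ℕ+, (k : ℝ) ^ (α + 3) * Real.sin (k * η.val) ≠ 0 := fun k =>
    mul_ne_zero (Real.rpow_pos_of_pos (pnat_pos k) _).ne' (sin_ne_zero η k)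
  obtain ⟨c, hc⟩ := exists_forall_abs_le_of_forall_summable
    (m := fun k : ℕ+ => coupling C ξ η k / (k : ℝ) ^ 3) fun a ha => by
      have h_mem := h (fun k => a k / ((k : ℝ) ^ (α + 3) * Real.sin (k * η.val)))
        (mem_coeffs_iff_summable_sq.2 (ha.congr fun k => by rw [mul_div_cancel₀ _ (h_ne k)]))
      refine (mem_coeffs_iff_summable_sq.1 h_mem).congr fun k => ?_
      have hk := pnat_pos k
      have h_pow : (k : ℝ) ^ (α + 3) = (k : ℝ) ^ α * (k : ℝ) ^ 3 := by
        rw [Real.rpow_add hk]; norm_cast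
      have h_sin := sin_ne_zero η k
      have h_rpow := (Real.rpow_pos_of_pos hk α).ne'
      rw [Pi.smul_apply, smul_eq_mul, h_pow, coupling]
      field_simp
  refine ⟨c, fun k => ?_⟩
  have hk : (0 : ℝ) < (k : ℝ) ^ 3 := pow_pos (pnat_pos k) 3
  simpa only [abs_div, abs_of_pos hk, div_le_iff₀ hk] using hc k

theorem MapsDomIntoState.smul_mem_coeffs_left (hdom : MapsDomIntoState A B C D ξ η) {a : ℕ+ → ℝ}
    (ha : a ∈ coeffs 2 η) : C • a ∈ coeffs (-1) ξ := by
  have h_force := (hdom (mkState 0 a 0 0 (zero_mem _) (coeffs_anti zero_le_two η ha) (zero_mem _)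
    (zero_mem _)) ⟨⟨⟨(coeffs 1 ξ).zero_mem, ha⟩, (coeffs 0 ξ).zero_mem⟩, (coeffs 0 η).zero_mem⟩).1
  simpa [stringForce] using h_force

theorem MapsDomIntoState.smul_mem_coeffs_right (hdom : MapsDomIntoState A B C D ξ η) {a : ℕ+ → ℝ}
    (ha : a ∈ coeffs 1 ξ) : B • a ∈ coeffs (-2) η := by
  have h_force := (hdom (mkState a 0 0 0 (coeffs_anti zero_le_one ξ ha) (zero_mem _) (zero_mem _)
    (zero_mem _)) ⟨⟨⟨ha, (coeffs 2 η).zero_mem⟩, (coeffs 0 ξ).zero_mem⟩, (coeffs 0 η).zero_mem⟩).2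
  simpa [beamForce] using h_force

theorem exists_isCoupling (hdom : MapsDomIntoState A B C D ξ η) :
    ∃ c, IsCoupling (B * C) c (coupling C ξ η) (coupling B η ξ) := by
  obtain ⟨c₁, h₁⟩ := exists_abs_coupling_le (C := C) (ξ := ξ) (η := η) (α := -1) fun a ha =>
    hdom.smul_mem_coeffs_left (by convert ha using 2; norm_num)
  obtain ⟨c₂, h₂⟩ := exists_abs_coupling_le (C := B) (ξ := η) (η := ξ) (α := -2) fun a ha =>
    hdom.smul_mem_coeffs_right (by convert ha using 2; norm_num)
  refine ⟨max c₁ c₂, ?_, fun k => ?_, fun k => (h₁ k).trans ?_, fun k => (h₂ k).trans ?_⟩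
  · have h_one := (abs_nonneg _).trans (h₁ 1)
    rw [PNat.one_coe, Nat.cast_one, one_pow, mul_one] at h_one
    exact h_one.trans (le_max_left _ _)
  · have hξ := sin_ne_zero ξ k
    have hη := sin_ne_zero η k
    unfold coupling
    field_simp
  · gcongr
    exact le_max_left _ _
  · gcongr
    exact le_max_right _ _

end Coupling

/-! ### The generator -/

/-- The determinant of `blockGen A D k g h` for `g * h = p`. -/
def blockDet (A D p k : ℝ) : ℝ := (k ^ 2 + A) * (k ^ 4 + D) - p

section Estimate

variable {A D p c : ℝ} {g h : ℕ+ → ℝ}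

theorem tendsto_blockDet_div (A D p : ℝ) :
    Tendsto (fun k : ℕ+ => blockDet A D p k / (k : ℝ) ^ 6) cofinite (𝓝 1) := by
  have h_inv : Tendsto (fun k : ℕ+ => ((k : ℝ))⁻¹) cofinite (𝓝 0) :=
    tendsto_inv_atTop_nhds_zero_nat.comp
      (Nat.cofinite_eq_atTop ▸ PNat.coe_injective.tendsto_cofinite)
  have h_lim := (((h_inv.pow 2).const_mul A).const_add 1).mul
    (((h_inv.pow 4).const_mul D).const_add 1) |>.sub ((h_inv.pow 6).const_mul p)
  refine (h_lim.congr fun k => ?_).trans_eq (by norm_num)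
  rw [blockDet]
  field_simp

theorem exists_pow_six_le {f : ℕ+ → ℝ} (hf : ∀ k, 0 < f k)
    (h_lim : Tendsto (fun k : ℕ+ => f k / (k : ℝ) ^ 6) cofinite (𝓝 1)) :
    ∃ C, 0 ≤ C ∧ ∀ k : ℕ+, (k : ℝ) ^ 6 ≤ C * f k := by
  obtain ⟨C, hC⟩ := (h_lim.inv₀ one_ne_zero).bddAbove_range_of_cofinite
  have h_le : ∀ k : ℕ+, (k : ℝ) ^ 6 / f k ≤ C := fun k => by
    simpa only [inv_div] using hC (Set.mem_range_self k)
  exact ⟨C, (div_nonneg (by positivity) (hf 1).le).trans (h_le 1),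
    fun k => (div_le_iff₀ (hf k)).1 (h_le k)⟩

/-- Cramer's rule for the positions in the block equation. -/
theorem blockDet_mul_apply {k g h : ℝ} (hk : k ≠ 0) (hgh : g * h = p) (z : ℝ⁴) :
    blockDet A D p k * z 0 = -(k ^ 4 + D) * k * blockGen A D k g h z 2 +
      g * k ^ 2 * blockGen A D k g h z 3 ∧
    blockDet A D p k * z 1 = h * k * blockGen A D k g h z 2 +
      -(k ^ 2 + A) * k ^ 2 * blockGen A D k g h z 3 := by
  rw [blockDet, ← hgh, blockGen_apply]
  simp only [Matrix.cons_val]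
  constructor <;> field_simp <;> ring

theorem abs_pow_add_le {k : ℝ} (hk : 1 ≤ k) (n : ℕ) (a : ℝ) : |k ^ n + a| ≤ (1 + |a|) * k ^ n := by
  have h_pow := one_le_pow₀ hk (n := n)
  calc |k ^ n + a| ≤ |k ^ n| + |a| := abs_add_le _ _
    _ ≤ k ^ n + |a| * k ^ n := by
        rw [abs_of_pos (by linarith)]
        gcongr
        exact le_mul_of_one_le_right (abs_nonneg a) h_pow
    _ = (1 + |a|) * k ^ n := by ring

theorem abs_blockDet_mul_le (hgh : IsCoupling p c g h) (k : ℕ+) (z : ℝ⁴) :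
    |blockDet A D p k| * (k * |z 0|) ≤
      (1 + |A| + |D| + c) * k ^ 6 * ‖blockGen A D k (g k) (h k) z‖ ∧
    |blockDet A D p k| * (k ^ 2 * |z 1|) ≤
      (1 + |A| + |D| + c) * k ^ 6 * ‖blockGen A D k (g k) (h k) z‖ := by
  have hk : (1 : ℝ) ≤ k := by exact_mod_cast k.pos
  have hk₀ := pnat_pos k
  have hA := abs_pow_add_le hk 2 A
  have hD := abs_pow_add_le hk 4 D
  obtain ⟨h_fst, h_snd⟩ := blockDet_mul_apply (A := A) (D := D) hk₀.ne' (hgh.mul_eq k) z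
  set w := blockGen A D k (g k) (h k) z
  have h_w := abs_apply_le_norm w
  have h_c := hgh.nonneg
  constructor
  · calc |blockDet A D p k| * (k * |z 0|)
        = k * |-(k ^ 4 + D) * k * w 2 + g k * k ^ 2 * w 3| := by rw [← h_fst, abs_mul]; ring
      _ ≤ k * ((1 + |D|) * k ^ 4 * k * ‖w‖ + c * k ^ 3 * k ^ 2 * ‖w‖) := by
          refine mul_le_mul_of_nonneg_left ((abs_add_le _ _).trans (add_le_add ?_ ?_)) hk₀.le
          · rw [abs_mul, abs_mul, abs_neg, abs_of_pos hk₀]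
            gcongr
            exact h_w 2
          · rw [abs_mul, abs_mul, abs_of_pos (pow_pos hk₀ 2)]
            gcongr
            exacts [hgh.abs_left_le k, h_w 3]
      _ = (1 + |D| + c) * k ^ 6 * ‖w‖ := by ring
      _ ≤ _ := by gcongr ?_ * _ * _; linarith [abs_nonneg A]
  · calc |blockDet A D p k| * (k ^ 2 * |z 1|)
        = k ^ 2 * |h k * k * w 2 + -(k ^ 2 + A) * k ^ 2 * w 3| := by
          rw [← h_snd, abs_mul]; ring
      _ ≤ k ^ 2 * (c * k ^ 3 * k * ‖w‖ + (1 + |A|) * k ^ 2 * k ^ 2 * ‖w‖) := by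
          refine mul_le_mul_of_nonneg_left ((abs_add_le _ _).trans (add_le_add ?_ ?_))
            (sq_nonneg _)
          · rw [abs_mul, abs_mul, abs_of_pos hk₀]
            gcongr
            exacts [hgh.abs_right_le k, h_w 2]
          · rw [abs_mul, abs_mul, abs_neg, abs_of_pos (pow_pos hk₀ 2)]
            gcongr
            exact h_w 3
      _ = (1 + |A| + c) * k ^ 6 * ‖w‖ := by ring
      _ ≤ _ := by gcongr ?_ * _ * _; linarith [abs_nonneg D]

/-- With `ε = 1` the positions are controlled by the graph norm of the generator, and with `ε = 0`
by the generator alone if all blocks are invertible. -/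
theorem exists_position_le (hgh : IsCoupling p c g h) {ε : ℝ} (hε : 0 ≤ ε)
    (h_det : ∀ k : ℕ+, 0 < |blockDet A D p k| + ε) :
    ∃ R, ∀ (k : ℕ+) (z : ℝ⁴),
      k * |z 0| ≤ R * (‖blockGen A D k (g k) (h k) z‖ + ε * ‖z‖) ∧
      k ^ 2 * |z 1| ≤ R * (‖blockGen A D k (g k) (h k) z‖ + ε * ‖z‖) := by
  have h_lim : Tendsto (fun k : ℕ+ => (|blockDet A D p k| + ε) / (k : ℝ) ^ 6) cofinite (𝓝 1) := by
    have h_ε := (summable_one_div_pnat_sq.tendsto_cofinite_zero.pow 3).const_mul ε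
    refine ((tendsto_blockDet_div A D p).abs.add h_ε |>.congr fun k => ?_).trans_eq (by norm_num)
    rw [abs_div, abs_of_pos (pow_pos (pnat_pos k) 6)]
    ring
  obtain ⟨C, hC, h_le⟩ := exists_pow_six_le h_det h_lim
  set N := 1 + |A| + |D| + c
  have hN : 1 ≤ N := by linarith [abs_nonneg A, abs_nonneg D, hgh.nonneg]
  have h_of_le : ∀ (k : ℕ+) {x v u : ℝ}, 0 ≤ x → x ≤ (k : ℝ) ^ 6 * u →
      |blockDet A D p k| * x ≤ N * k ^ 6 * v → x ≤ C * N * (v + ε * u) := by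
    intro k x v u hx hxu hxv
    refine le_of_mul_le_mul_left ?_ (pow_pos (pnat_pos k) 6)
    calc (k : ℝ) ^ 6 * x ≤ C * (|blockDet A D p k| + ε) * x := by gcongr; exact h_le k
      _ = C * (|blockDet A D p k| * x + 1 * (ε * x)) := by ring
      _ ≤ C * (N * k ^ 6 * v + N * (ε * (k ^ 6 * u))) := by gcongr
      _ = k ^ 6 * (C * N * (v + ε * u)) := by ring
  refine ⟨C * N, fun k z => ?_⟩
  have hk : (1 : ℝ) ≤ k := by exact_mod_cast k.pos
  obtain ⟨h_fst, h_snd⟩ := abs_blockDet_mul_le (A := A) (D := D) hgh k z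
  refine ⟨h_of_le k (by positivity) ?_ h_fst, h_of_le k (by positivity) ?_ h_snd⟩
  · gcongr
    exacts [le_self_pow₀ hk (by norm_num), abs_apply_le_norm z 0]
  · gcongr
    exacts [by norm_num, abs_apply_le_norm z 1]

end Estimate

section Generator

variable {A B C D : ℝ} {ξ η : IrrPoint}

theorem rescale_opA (hdom : MapsDomIntoState A B C D ξ η) (U : (opA hdom).domain) (k : ℕ+) :
    rescale ξ η (opA hdom U) k =
      blockGen A D k (coupling C ξ η k) (coupling B η ξ k) (rescale ξ η U.1 k) := by
  have hξ := sin_ne_zero ξ k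
  have hη := sin_ne_zero η k
  have h_opA : rescale ξ η (opA hdom U) k =
      !₂[Real.sin (k * ξ.val) * v₁ U.1 k, Real.sin (k * η.val) * v₂ U.1 k,
        Real.sin (k * ξ.val) / k * (-(k : ℝ) ^ 2 * u₁ U.1 k - A * u₁ U.1 k - C * u₂ U.1 k),
        Real.sin (k * η.val) / (k : ℝ) ^ 2 *
          (-(-(k : ℝ) ^ 2 * (-(k : ℝ) ^ 2 * u₂ U.1 k)) - B * u₁ U.1 k - D * u₂ U.1 k)] := rfl
  rw [h_opA, rescale_apply, rescaleFun, blockGen_apply, coupling, coupling]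
  generalize Real.sin (k * ξ.val) = s at hξ ⊢
  generalize Real.sin (k * η.val) = s' at hη ⊢
  ext i
  fin_cases i <;> simp only [Fin.mk_one, Fin.zero_eta, Fin.reduceFinMk, Matrix.cons_val]
  · field_simp
  · field_simp
  · field_simp
    ring
  · field_simp
    ring

theorem mem_dom_of_rescale (hdom : MapsDomIntoState A B C D ξ η) {U V : StateSpace ξ η}
    (hUV : ∀ k : ℕ+, blockGen A D k (coupling C ξ η k) (coupling B η ξ k) (rescale ξ η U k) =
      rescale ξ η V k) : U ∈ dom ξ η := by
  obtain ⟨c, hgh⟩ := exists_isCoupling hdom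
  obtain ⟨R, h_le⟩ := exists_position_le (A := A) (D := D) hgh zero_le_one
    fun k => add_pos_of_nonneg_of_pos (abs_nonneg _) one_pos
  have h_sum : Summable fun k => (R * (‖rescale ξ η V k‖ + 1 * ‖rescale ξ η U k‖)) ^ 2 := by
    refine (((ell2_summable_norm_sq (rescale ξ η V)).add
      (ell2_summable_norm_sq (rescale ξ η U))).mul_left (R ^ 2 * 2)).of_nonneg_of_le
      (fun _ => sq_nonneg _) fun k => ?_
    rw [mul_pow, one_mul, mul_assoc]
    gcongr
    exact add_sq_le
  refine mem_dom.2 ⟨⟨⟨mem_coeffs_of_abs_le h_sum fun k => ?_,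
    mem_coeffs_of_abs_le h_sum fun k => ?_⟩,
    mem_coeffs_of_eq_apply (rescale ξ η V) 0 fun k => ?_⟩,
    mem_coeffs_of_eq_apply (rescale ξ η V) 1 fun k => ?_⟩
  · rw [Real.rpow_one, mul_assoc, abs_mul, abs_of_pos (pnat_pos k), ← hUV k]
    exact (h_le k (rescale ξ η U k)).1
  · rw [Real.rpow_two, mul_assoc, abs_mul, abs_of_pos (pow_pos (pnat_pos k) 2), ← hUV k]
    exact (h_le k (rescale ξ η U k)).2
  · rw [Real.rpow_zero, ← hUV k]
    change _ = (k : ℝ) * (Real.sin (k * ξ.val) / k * v₁ U k)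
    field_simp
  · rw [Real.rpow_zero, ← hUV k]
    change _ = (k : ℝ) ^ 2 * (Real.sin (k * η.val) / (k : ℝ) ^ 2 * v₂ U k)
    field_simp

theorem mem_graph_opA_iff (hdom : MapsDomIntoState A B C D ξ η) (U V : StateSpace ξ η) :
    (U, V) ∈ (opA hdom).graph ↔
      ∀ k : ℕ+, blockGen A D k (coupling C ξ η k) (coupling B η ξ k) (rescale ξ η U k) =
        rescale ξ η V k := by
  rw [LinearPMap.mem_graph_iff]
  constructor
  · rintro ⟨U', rfl, rfl⟩ k
    exact (rescale_opA hdom U' k).symm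
  · intro h
    refine ⟨⟨U, mem_dom_of_rescale hdom h⟩, rfl, (rescale ξ η).injective ?_⟩
    ext k : 2
    rw [rescale_opA hdom, ← h k]

theorem hypH1_opA (hdom : MapsDomIntoState A B C D ξ η) : HypH1 (opA hdom) := by
  obtain ⟨c, hgh⟩ := exists_isCoupling hdom
  have hM := flowBounded_blockGen A D hgh
  have h_group := isStronglyContinuousGroup_blockGroup hM
  let Θ := (rescale ξ η).toContinuousLinearEquiv
  refine ⟨fun t => (Θ.symm : _ →L[ℝ] StateSpace ξ η).comp
    ((blockGroup hM t).comp (Θ : StateSpace ξ η →L[ℝ] _)), ⟨?_, fun s t => ?_, fun U => ?_⟩,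
    fun U V => ?_⟩
  · ext U
    simp [h_group.map_zero]
  · ext U
    simp [h_group.map_add]
  · exact Θ.symm.continuous.comp (h_group.continuous (Θ U))
  · rw [mem_graph_opA_iff, ← tendsto_slope_blockGroup_iff hM,
      Θ.toHomeomorph.isInducing.tendsto_nhds_iff]
    refine tendsto_congr fun t => ?_
    simp [Θ, map_smul, map_sub]

end Generator

/-! ### The observation -/

section Observation

variable {A B C D : ℝ} {ξ η : IrrPoint}

theorem hasSum_euclidean_two {ι : Type*} {f : ι → ℝ²} {a b : ℝ}
    (ha : HasSum (fun k => f k 0) a) (hb : HasSum (fun k => f k 1) b) : HasSum f !₂[a, b] := by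
  have h_pi : HasSum (fun k => WithLp.ofLp (f k)) (![a, b] : Fin 2 → ℝ) := by
    rw [Pi.hasSum]
    intro i
    fin_cases i
    exacts [ha, hb]
  exact h_pi.mapL ((PiLp.continuousLinearEquiv 2 ℝ fun _ : Fin 2 => ℝ).symm :
    (Fin 2 → ℝ) →L[ℝ] ℝ²)

theorem hasSum_opB (U : (opB ξ η).domain) :
    HasSum (fun k => √(2 / Real.pi) • posProj (rescale ξ η U.1 k)) (opB ξ η U) := by
  have h_coeff (k : ℕ+) : √(2 / Real.pi) • posProj (rescale ξ η U.1 k) =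
      !₂[u₁ U.1 k * w k ξ.val, u₂ U.1 k * w k η.val] := by
    ext i
    fin_cases i <;> simp [posProj_apply, rescale_apply, rescaleFun, w] <;> ring
  have hU : U.1 ∈ dom ξ η := U.2
  simp only [h_coeff]
  exact hasSum_euclidean_two (summable_valueAt hU.1.1.1).hasSum
    (summable_valueAt (coeffs_anti one_le_two η hU.1.1.2)).hasSum

theorem rescale_solution (hdom : MapsDomIntoState A B C D ξ η) {U₀ : StateSpace ξ η}
    {U : ℝ → StateSpace ξ η} (hU : IsSolution (opA hdom) U₀ U) (t : ℝ) (k : ℕ+) :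
    rescale ξ η (U t) k =
      flow (blockGen A D k (coupling C ξ η k) (coupling B η ξ k)) t (rescale ξ η U₀ k) := by
  have h_deriv (t : ℝ) : HasDerivAt (fun t => rescale ξ η (U t) k)
      (blockGen A D k (coupling C ξ η k) (coupling B η ξ k) (rescale ξ η (U t) k)) t := by
    rw [← rescale_opA hdom ⟨U t, hU.mem t⟩ k]
    exact ((lp.evalCLM ℝ (fun _ : ℕ+ => ℝ⁴) 2 k).comp
      ((rescale ξ η).toContinuousLinearEquiv :
        StateSpace ξ η →L[ℝ] _)).hasFDerivAt.comp_hasDerivAt t (hU.hasDerivAt t)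
  rw [eq_flow_of_hasDerivAt h_deriv t, hU.init]

theorem L2norm_eq_norm_toLp {G : Type*} [NormedAddCommGroup G] {a b : ℝ} {f : ℝ → G}
    (hf : MemLp f 2 (volume.restrict (Set.Icc a b))) : L2norm a b f = ‖hf.toLp f‖ := by
  rw [L2norm, Lp.norm_toLp, hf.eLpNorm_eq_integral_rpow_norm (by norm_num) (by norm_num)]
  simp only [ENNReal.toReal_ofNat, Real.rpow_ofNat]
  rw [ENNReal.toReal_ofReal (by positivity), Real.sqrt_eq_rpow, one_div]

theorem dom_opA_le_opB (hdom : MapsDomIntoState A B C D ξ η) :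
    (opA hdom).domain ≤ (opB ξ η).domain := le_rfl

theorem opB_solution (hdom : MapsDomIntoState A B C D ξ η) {c : ℝ}
    (hgh : IsCoupling (B * C) c (coupling C ξ η) (coupling B η ξ)) (m : ℕ) {U₀ : StateSpace ξ η}
    {U : ℝ → StateSpace ξ η} (hU : IsSolution (opA hdom) U₀ U) :
    MemLp (fun t => opB ξ η ⟨U t, dom_opA_le_opB hdom (hU.mem t)⟩) 2
      (volume.restrict (Set.Icc 0 (2 * Real.pi * m))) ∧
    L2norm 0 (2 * Real.pi * m) (fun t => opB ξ η ⟨U t, dom_opA_le_opB hdom (hU.mem t)⟩) =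
      √(2 / Real.pi) * ‖obs (admissible_blockGen A D hgh m) (rescale ξ η U₀)‖ := by
  set ψ : ℝ → ℝ² := fun t => opB ξ η ⟨U t, dom_opA_le_opB hdom (hU.mem t)⟩
  have hκ : 0 < √(2 / Real.pi) := Real.sqrt_pos.2 (by positivity)
  set F := obs (admissible_blockGen A D hgh m) (rescale ξ η U₀)
  have hF : F =ᵐ[volume.restrict (Set.Icc 0 (2 * Real.pi * m))]
      fun t => (√(2 / Real.pi))⁻¹ • ψ t := by
    refine obs_ae_eq _ _ fun t => ?_
    have h_sum := (hasSum_opB ⟨U t, dom_opA_le_opB hdom (hU.mem t)⟩).const_smul (√(2 / Real.pi))⁻¹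
    simpa only [inv_smul_smul₀ hκ.ne', rescale_solution hdom hU] using h_sum
  have hψ : (√(2 / Real.pi) • F : Lp ℝ² 2 _) =ᵐ[volume.restrict (Set.Icc 0 (2 * Real.pi * m))] ψ :=
    (Lp.coeFn_smul _ F).trans (hF.mono fun t ht => by
      rw [Pi.smul_apply, ht, smul_inv_smul₀ hκ.ne'])
  have hψ_mem := (Lp.memLp _).ae_eq hψ
  refine ⟨hψ_mem, ?_⟩
  rw [L2norm_eq_norm_toLp hψ_mem, MemLp.toLp_congr hψ_mem (Lp.memLp _) hψ.symm, Lp.toLp_coeFn,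
    norm_smul, Real.norm_of_nonneg hκ.le]

theorem hypH3_opA (hdom : MapsDomIntoState A B C D ξ η) : HypH3 (opA hdom) (opB ξ η) := by
  obtain ⟨c, hgh⟩ := exists_isCoupling hdom
  let S := obs (admissible_blockGen A D hgh 1)
  refine ⟨dom_opA_le_opB hdom, 0, 2 * Real.pi * (1 : ℕ), √(2 / Real.pi) * ‖S‖, by positivity,
    fun U₀ _ U hU => ?_⟩
  obtain ⟨h_mem, h_norm⟩ := opB_solution hdom hgh 1 hU
  refine ⟨h_mem, ?_⟩
  calc L2norm 0 (2 * Real.pi * (1 : ℕ)) _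
      = √(2 / Real.pi) * ‖S (rescale ξ η U₀)‖ := h_norm
    _ ≤ √(2 / Real.pi) * (‖S‖ * ‖rescale ξ η U₀‖) := by gcongr; exact S.le_opNorm _
    _ = √(2 / Real.pi) * ‖S‖ * ‖U₀‖ := by rw [(rescale ξ η).norm_map]; ring

theorem hypH4_opA (hdom : MapsDomIntoState A B C D ξ η) (h_gen : Generic A D (B * C)) :
    HypH4 (opA hdom) (opB ξ η) := by
  obtain ⟨c, hgh⟩ := exists_isCoupling hdom
  obtain ⟨m, hm, c', hc', h_obs⟩ := h_gen.exists_norm_le_obs_blockGen hgh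
  refine ⟨dom_opA_le_opB hdom, 0, 2 * Real.pi * m, c' / √(2 / Real.pi), by positivity,
    by positivity, fun U₀ _ U hU => ?_⟩
  obtain ⟨h_mem, h_norm⟩ := opB_solution hdom hgh m hU
  refine ⟨h_mem, ?_⟩
  rw [h_norm, ← (rescale ξ η).norm_map U₀]
  refine (h_obs (rescale ξ η U₀)).trans_eq ?_
  field_simp

theorem norm_hasSum_le {ι E G : Type*} [NormedAddCommGroup E] [NormedAddCommGroup G]
    {f : ι → G} {x : G} {b : ι → ℝ} (hf : HasSum f x) (hb : Summable fun k => b k ^ 2)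
    (v : ℓ²(ι, E)) (h_le : ∀ k, ‖f k‖ ≤ b k * ‖v k‖) : ‖x‖ ≤ √(∑' k, b k ^ 2) * ‖v‖ := by
  refine le_of_tendsto hf.norm (Eventually.of_forall fun s => ?_)
  calc ‖∑ k ∈ s, f k‖ ≤ ∑ k ∈ s, b k * ‖v k‖ := norm_sum_le_of_le s fun k _ => h_le k
    _ ≤ √(∑ k ∈ s, b k ^ 2) * √(∑ k ∈ s, ‖v k‖ ^ 2) := Real.sum_mul_le_sqrt_mul_sqrt s _ _
    _ ≤ √(∑' k, b k ^ 2) * ‖v‖ := by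
        gcongr
        · exact hb.sum_le_tsum s fun _ _ => sq_nonneg _
        · refine Real.sqrt_le_iff.2 ⟨norm_nonneg _, ?_⟩
          rw [ell2_norm_sq]
          exact (ell2_summable_norm_sq v).sum_le_tsum s fun _ _ => sq_nonneg _

theorem hypH2_opA (hdom : MapsDomIntoState A B C D ξ η) (h_gen : Generic A D (B * C)) :
    HypH2 (opA hdom) (opB ξ η) := by
  obtain ⟨c, hgh⟩ := exists_isCoupling hdom
  obtain ⟨R, h_le⟩ := exists_position_le (A := A) (D := D) hgh le_rfl fun k => by
    simpa only [add_zero, blockDet] using abs_pos.2 (sub_ne_zero.2 (h_gen.det_ne k))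
  let b (k : ℕ+) : ℝ := √(2 / Real.pi) * (2 * R) * (1 / (k : ℝ))
  have hb : Summable fun k => b k ^ 2 := by
    simpa only [b, mul_pow] using summable_one_div_pnat_sq.mul_left _
  refine ⟨dom_opA_le_opB hdom, √(∑' k, b k ^ 2), fun U => ?_⟩
  rw [← (rescale ξ η).norm_map (opA hdom U)]
  refine norm_hasSum_le (hasSum_opB ⟨U.1, dom_opA_le_opB hdom U.2⟩) hb _ fun k => ?_
  obtain ⟨h_fst, h_snd⟩ := h_le k (rescale ξ η U.1 k)
  rw [← rescale_opA hdom U k, zero_mul, add_zero] at h_fst h_snd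
  have hk : (1 : ℝ) ≤ k := by exact_mod_cast k.pos
  have h_pos : ‖posProj (rescale ξ η U.1 k)‖ ≤ 2 * (R * ‖rescale ξ η (opA hdom U) k‖ / k) := by
    refine norm_le_of_abs_apply_le_two fun i => (le_div_iff₀' (pnat_pos k)).2 ?_
    rw [posProj_apply]
    fin_cases i
    · exact h_fst
    · refine (mul_le_mul_of_nonneg_right ?_ (abs_nonneg _)).trans h_snd
      exact le_self_pow₀ hk two_ne_zero
  rw [norm_smul, Real.norm_of_nonneg (Real.sqrt_nonneg _)]
  calc √(2 / Real.pi) * ‖posProj (rescale ξ η U.1 k)‖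
      ≤ √(2 / Real.pi) * (2 * (R * ‖rescale ξ η (opA hdom U) k‖ / k)) := by gcongr
    _ = b k * ‖rescale ξ η (opA hdom U) k‖ := by ring

end Observation

end StringBeam

end

open StringBeam in
theorem proposition3p1 (ξ η : IrrPoint) :
    (∀ (A B C D : ℝ) (h : MapsDomIntoState A B C D ξ η),
      HypH1 (opA h) ∧ HypH3 (opA h) (opB ξ η)) ∧
    (∀ᵐ p : ℝ × ℝ × ℝ × ℝ, ∀ A B C D : ℝ, p = (A, B, C, D) →
      ∀ h : MapsDomIntoState A B C D ξ η,
        HypH1 (opA h) ∧ HypH2 (opA h) (opB ξ η) ∧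
        HypH3 (opA h) (opB ξ η) ∧ HypH4 (opA h) (opB ξ η)) := by
  refine ⟨fun A B C D h => ⟨hypH1_opA h, hypH3_opA h⟩, ?_⟩
  filter_upwards [ae_generic] with p hp A B C D hpe h
  subst hpe
  exact ⟨hypH1_opA h, hypH2_opA h hp, hypH3_opA h, hypH4_opA h hp⟩
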